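/- **Setting.** Let $m\geq 1$ be an integer, let $(\mathcal H_i)_{1\leq i\leq m}$ be real Hilbert spaces, and set $\mathcal H_0=\mathcal H_m=\mathcal H$. For a real Hilbert space $\mathcal G$, $\Gamma_0(\mathcal G)$ is the class of lower semicontinuous convex functions $f\colon\mathcal G\to\left]-\infty,+\infty\right]$ with $\operatorname{dom} f=\{x\mid f(x)<+\infty\}\neq\varnothing$; for $f\in\Gamma_0(\mathcal G)$, $\partial f$ is the subdifferential, $f^*$ the conjugate, and $\operatorname{prox}_f(x)=\operatorname{argmin}_{y\in\mathcal G}\big(f(y)+\|x-y\|^2/2\big)$. For every $i\in\{1,\dots,m\}$, let $W_i\colon\mathcal H_{i-1}\to\mathcal H_i$ be bounded and linear, let $b_i\in\mathcal H_i$, let $\varphi_i\in\Gamma_0(\mathcal H_i)$ satisfy $\varphi_i(0)=\inf\varphi_i(\mathcal H_i)$, and set $T_i\colon\mathcal H_{i-1}\to\mathcal H_i\colon x\mapsto\operatorname{prox}_{\varphi_i}(W_ix+b_i)$. Let $\boldsymbol{\mathcal H}=\mathcal H_1\oplus\cdots\oplus\mathcal H_m$ and $\overset{\rightarrow}{\boldsymbol{\mathcal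 H}}=\mathcal H_m\oplus\mathcal H_1\oplus\cdots\oplus\mathcal H_{m-1}$ (Hilbert direct sums), and write $\boldsymbol x=(x_1,\dots,x_m)$, $x_0=x_m$, for a generic element of $\boldsymbol{\mathcal H}$. Set $$F=\operatorname{Fix}(T_m\circ\cdots\circ T_1),\qquad \boldsymbol F=\{\boldsymbol x\in\boldsymbol{\mathcal H}\mid x_i=T_ix_{i-1},\ 1\leq i\leq m\},$$ $$\boldsymbol S\colon\boldsymbol{\mathcal H}\to\overset{\rightarrow}{\boldsymbol{\mathcal H}}\colon(x_1,\dots,x_m)\mapsto(x_m,x_1,\dots,x_{m-1}),\qquad \boldsymbol W\colon\overset{\rightarrow}{\boldsymbol{\mathcal H}}\to\boldsymbol{\mathcal H}\colon(x_m,x_1,\dots,x_{m-1})\mapsto(W_1x_m,W_2x_1,\dots,W_mx_{m-1}),$$ $$\boldsymbol\varphi(\boldsymbol x)=\sum_{i=1}^m\varphi_i(x_i),\qquad \boldsymbol\psi(\boldsymbol x)=\sum_{i=1}^m\big(\varphi_i(x_i)-\langle x_i\mid b_i\rangle\big).$$ For $\alpha\in[1/2,1]$, say that $(W_i)_{1\leq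 i\leq m}$ satisfies condition $\mathrm C(\alpha)$ if, with $$L_i(x_0,\dots,x_{i-1})=\sum_{k=0}^{i-1}(W_i\circ\cdots\circ W_{k+1})x_k\in\mathcal H_i\qquad(1\leq i\leq m),$$ every $\boldsymbol x=(x_0,\dots,x_{m-1})\in\mathcal H_0\times\cdots\times\mathcal H_{m-1}$ such that $\|x_0\|\leq1$ and $\|x_i\|\leq\|L_i(x_0,\dots,x_{i-1})\|$ for $1\leq i\leq m-1$ satisfies $$\|L_m\boldsymbol x-2^m(1-\alpha)x_0\|+\|L_m\boldsymbol x\|\leq2^m\alpha\|x_0\|.$$ (In this condition $x_0,\dots,x_{m-1}$ are independent vectors.) **Proposition.** Consider the problem of finding $\overline x_1\in\mathcal H_1,\dots,\overline x_m\in\mathcal H_m$ such that, with $\overline x_0=\overline x_m$, $$b_i\in\overline x_i-W_i\overline x_{i-1}+\partial\varphi_i(\overline x_i)\qquad\text{for every } i\in\{1,\dots,m\}.\tag{VI}$$ Then the following hold. (i) The set of solutions to (VI) is $\boldsymbol F$. (ii) $\boldsymbol F=\operatorname{zer}(\mathbf{Id}-\boldsymbol W\circ\boldsymbol S+\partial\boldsymbol\psi)=\operatorname{Fix}(\operatorname{prox}_{\boldsymbol\psi}\circ\boldsymbol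 W\circ\boldsymbol S)$. (iii) $\boldsymbol F=\{(T_1\overline x_m,(T_2\circ T_1)\overline x_m,\dots,(T_{m-1}\circ\cdots\circ T_1)\overline x_m,\overline x_m)\mid\overline x_m\in F\}$. (iv) If $(W_i)_{1\leq i\leq m}$ satisfies $\mathrm C(\alpha)$ for some $\alpha\in[1/2,1]$, then $F$ is closed and convex. (v) If $(W_i)_{1\leq i\leq m}$ satisfies $\mathrm C(\alpha)$ for some $\alpha\in[1/2,1]$, and if (a) $\operatorname{ran}(T_m\circ\cdots\circ T_1)$ is bounded or (b) $\operatorname{dom}\varphi_j$ is bounded for some $j\in\{1,\dots,m\}$, then $F$ and $\boldsymbol F$ are nonempty. (vi) Suppose that $\mathbf{Id}-\boldsymbol W\circ\boldsymbol S$ is monotone. Then $\boldsymbol F$ is closed and convex. In addition, $F$ and $\boldsymbol F$ are nonempty if any of the following holds: (a) $\mathbf{Id}-\boldsymbol W\circ\boldsymbol S+\partial\boldsymbol\varphi$ is surjective. (b) $\partial\boldsymbol\varphi-\boldsymbol W\circ\boldsymbol S$ is maximally monotone. (c) $\max_{1\leq i\leq m}\|W_i\|\leq1$, $\boldsymbol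 S^*-\boldsymbol W$ has closed range, and $\ker(\boldsymbol S-\boldsymbol W^*)=\{\boldsymbol 0\}$. (d) $\max_{1\leq i\leq m}\|W_i\|\leq1$ and, for every $i\in\{1,\dots,m\}$, $\operatorname{dom}\varphi_i^*=\mathcal H_i$. (e) For every $i\in\{1,\dots,m\}$, $\operatorname{dom}\varphi_i=\mathcal H_i$ and $\operatorname{dom}\varphi_i^*=\mathcal H_i$. (f) $\boldsymbol S^*-\boldsymbol W$ has closed range, $\ker(\boldsymbol S-\boldsymbol W^*)=\{\boldsymbol 0\}$, and, for every $i\in\{1,\dots,m\}$, $\operatorname{dom}\varphi_i=\mathcal H_i$. (g) For every $i\in\{1,\dots,m\}$, $\operatorname{dom}\varphi_i$ is bounded. -/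

import Mathlib

open scoped Pointwise

noncomputable section

namespace VINet

/-! ### Convex analysis and set-valued operators on a real Hilbert space -/

section Convex

variable {E : Type*} [NormedAddCommGroup E] [InnerProductSpace ℝ E]

/-- The (effective) domain of an extended-real-valued function. -/
def dom (f : E → EReal) : Set E := {x | f x < ⊤}

/-- The class `Γ₀(E)`: lower semicontinuous convex functions `E → ]-∞, +∞]` with nonempty domain.
Convexity means convexity of the epigraph. -/
structure IsGamma0 (f : E → EReal) : Prop where
  ne_bot : ∀ x, f x ≠ ⊥
  dom_nonempty : (dom f).Nonempty
  lsc : LowerSemicontinuous f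
  convex_epigraph : Convex ℝ {p : E × ℝ | f p.1 ≤ (p.2 : EReal)}

/-- The subdifferential `∂f(x) = {u | ∀ y, ⟪y - x, u⟫ + f x ≤ f y}`. -/
def subdifferential (f : E → EReal) (x : E) : Set E :=
  {u | ∀ y, ((inner ℝ (y - x) u : ℝ) : EReal) + f x ≤ f y}

/-- The Fenchel conjugate `f* (u) = sup_x (⟪x, u⟫ - f x)`. -/
def conjugate (f : E → EReal) (u : E) : EReal :=
  ⨆ x, ((inner ℝ x u : ℝ) : EReal) - f x

/-- `p` minimizes `y ↦ f y + ‖x - y‖ ^ 2 / 2` over `E`. -/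
def IsProxPoint (f : E → EReal) (x p : E) : Prop :=
  ∀ y, f p + ((‖x - p‖ ^ 2 / 2 : ℝ) : EReal) ≤ f y + ((‖x - y‖ ^ 2 / 2 : ℝ) : EReal)

/-- The proximity operator `prox_f x = argmin_y (f y + ‖x - y‖ ^ 2 / 2)`. On a Hilbert space, the
minimizer exists and is unique for every `f ∈ Γ₀(E)`, so that nothing is left to the choice. -/
def prox (f : E → EReal) (x : E) : E :=
  Classical.epsilon (IsProxPoint f x)

/-- The set-valued operator `x ↦ {f x}` of a mapping `f`. -/
def single (f : E → E) : E → Set E := fun x => {f x}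

/-- The zeros of a set-valued operator. -/
def zer (A : E → Set E) : Set E := {x | 0 ∈ A x}

/-- A set-valued operator is surjective if its range is the whole space. -/
def IsSurjectiveOp (A : E → Set E) : Prop := ∀ u, ∃ x, u ∈ A x

/-- Monotonicity of a set-valued operator. -/
def IsMonotoneOp (A : E → Set E) : Prop :=
  ∀ x y, ∀ u ∈ A x, ∀ v ∈ A y, 0 ≤ inner ℝ (x - y) (u - v)

/-- Maximal monotonicity: no point can be added to the graph without destroying monotonicity. -/
def IsMaximallyMonotoneOp (A : E → Set E) : Prop :=
  IsMonotoneOp A ∧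
    ∀ x u, (∀ y, ∀ v ∈ A y, 0 ≤ inner ℝ (x - y) (u - v)) → u ∈ A x

end Convex

/-! ### Cyclically arranged spaces

The `m = n + 1` spaces `H₁, …, H_m` are indexed by `Fin (n + 1)`: the space `H_{i+1}` is `H i`, and
`H₀ = H_m` is `H (Fin.last n)`. -/

/-- The cyclic predecessor in `Fin (n + 1)`: `prev 0 = n` and `prev (k + 1) = k`. -/
def prev {n : ℕ} : Fin (n + 1) → Fin (n + 1)
  | ⟨0, _⟩ => Fin.last n
  | ⟨k + 1, h⟩ => ⟨k, Nat.lt_of_succ_lt h⟩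

section Chain

variable {n : ℕ} {H : Fin (n + 1) → Type*}

/-- The composition `f_j ∘ ⋯ ∘ f_a` for `a ≤ j` (both ends included). -/
def chain (f : ∀ i, H (prev i) → H i) {a j : ℕ} (h : a ≤ j) :
    ∀ hj : j < n + 1, H (prev ⟨a, lt_of_le_of_lt h hj⟩) → H ⟨j, hj⟩ :=
  Nat.leRec (motive := fun j h =>
      ∀ hj : j < n + 1, H (prev ⟨a, lt_of_le_of_lt h hj⟩) → H ⟨j, hj⟩)
    (fun hj => f ⟨a, hj⟩)
    (fun j _ g hj => f ⟨j + 1, hj⟩ ∘ g (Nat.lt_of_succ_lt hj)) h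

/-- The composition `f_j ∘ ⋯ ∘ f_0`, which starts from `H₀ = H_m`. -/
def chainFromZero (f : ∀ i, H (prev i) → H i) (j : Fin (n + 1)) : H (Fin.last n) → H j :=
  chain f (Nat.zero_le j.1) j.2

end Chain

section AveragednessCondition

variable {n : ℕ} {H : Fin (n + 1) → Type*} [∀ i, NormedAddCommGroup (H i)]
  [∀ i, InnerProductSpace ℝ (H i)]

/-- In the numbering `1, …, m` of the operators, with `x = (x_0, …, x_{m-1})` and `x_k ∈ H_k`, this
is `L_i (x_0, …, x_{i-1}) = ∑_{k=0}^{i-1} (W_i ∘ ⋯ ∘ W_{k+1}) x_k` for `i = j + 1`. -/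
def partialSum (W : ∀ i, H (prev i) →L[ℝ] H i) (j : Fin (n + 1)) (x : ∀ k, H (prev k)) : H j :=
  ∑ k : Fin (n + 1), if h : k.1 ≤ j.1 then chain (fun i => ⇑(W i)) h j.2 (x k) else 0

/-- The condition on `(W_1, …, W_m)`, `m = n + 1`, with parameter `α`, that yields averagedness of
the compositions with firmly nonexpansive operators. -/
def AveragednessCondition (W : ∀ i, H (prev i) →L[ℝ] H i) (α : ℝ) : Prop :=
  ∀ x : ∀ k, H (prev k),
    let x₀ : H (Fin.last n) := x ⟨0, Nat.succ_pos n⟩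
    ‖x₀‖ ≤ 1 →
    (∀ (k : ℕ) (hk : k + 1 < n + 1),
      ‖x ⟨k + 1, hk⟩‖ ≤ ‖partialSum W ⟨k, Nat.lt_of_succ_lt hk⟩ x‖) →
    ‖partialSum W (Fin.last n) x - (2 ^ (n + 1) * (1 - α)) • x₀‖ + ‖partialSum W (Fin.last n) x‖
      ≤ 2 ^ (n + 1) * α * ‖x₀‖

end AveragednessCondition

/-! ### The network -/

/-- An autonomous network with `m = n + 1` layers: bounded linear operators `W_i : H_{i-1} → H_i`,
vectors `b_i ∈ H_i`, and functions `φ_i ∈ Γ₀(H_i)` that are minimal at `0`. -/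
structure Network (n : ℕ) (H : Fin (n + 1) → Type*) [∀ i, NormedAddCommGroup (H i)]
    [∀ i, InnerProductSpace ℝ (H i)] where
  W : ∀ i, H (prev i) →L[ℝ] H i
  b : ∀ i, H i
  φ : ∀ i, H i → EReal
  gamma0 : ∀ i, IsGamma0 (φ i)
  min_zero : ∀ i x, φ i 0 ≤ φ i x

/-- The cyclic shift `(x_1, …, x_m) ↦ (x_m, x_1, …, x_{m-1})` from `H_1 ⊕ ⋯ ⊕ H_m` to
`H_m ⊕ H_1 ⊕ ⋯ ⊕ H_{m-1}` (Hilbert direct sums). -/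
def shift {n : ℕ} (H : Fin (n + 1) → Type*) [∀ i, NormedAddCommGroup (H i)]
    [∀ i, InnerProductSpace ℝ (H i)] : PiLp 2 H →L[ℝ] PiLp 2 (fun i => H (prev i)) :=
  ((PiLp.continuousLinearEquiv 2 ℝ (fun i => H (prev i))).symm :
      (∀ i, H (prev i)) →L[ℝ] PiLp 2 (fun i => H (prev i))) ∘L
    ContinuousLinearMap.pi (fun i => PiLp.proj 2 H (prev i))

namespace Network

variable {n : ℕ} {H : Fin (n + 1) → Type*} [∀ i, NormedAddCommGroup (H i)]
  [∀ i, InnerProductSpace ℝ (H i)] (N : Network n H)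

/-- The layer `T_i : H_{i-1} → H_i`, `x ↦ prox_{φ_i} (W_i x + b_i)`. -/
def T (i : Fin (n + 1)) (x : H (prev i)) : H i := prox (N.φ i) (N.W i x + N.b i)

/-- The composition `T_m ∘ ⋯ ∘ T_1`. -/
def Tcomp : H (Fin.last n) → H (Fin.last n) := chainFromZero N.T (Fin.last n)

/-- `F = Fix (T_m ∘ ⋯ ∘ T_1)`. -/
def F : Set (H (Fin.last n)) := Function.fixedPoints N.Tcomp

/-- The block operator `(x_m, x_1, …, x_{m-1}) ↦ (W_1 x_m, W_2 x_1, …, W_m x_{m-1})`. -/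
def bigW : PiLp 2 (fun i => H (prev i)) →L[ℝ] PiLp 2 H :=
  ((PiLp.continuousLinearEquiv 2 ℝ H).symm : (∀ i, H i) →L[ℝ] PiLp 2 H) ∘L
    ContinuousLinearMap.pi (fun i => N.W i ∘L PiLp.proj 2 (fun i => H (prev i)) i)

/-- `x ↦ ∑ i, φ_i (x_i)`. -/
def bigφ (x : PiLp 2 H) : EReal := ∑ i, N.φ i (x i)

/-- `x ↦ ∑ i, (φ_i (x_i) - ⟪x_i, b_i⟫)`. -/
def bigψ (x : PiLp 2 H) : EReal := ∑ i, (N.φ i (x i) - ((inner ℝ (x i) (N.b i) : ℝ) : EReal))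

/-- The set of all `x` with `x_1 = T_1 x_m, x_2 = T_2 x_1, …, x_m = T_m x_{m-1}`. -/
def bigF : Set (PiLp 2 H) := {x | ∀ i, x i = N.T i (x (prev i))}

/-- The solutions of the variational inequality system
`b_i ∈ x_i - W_i x_{i-1} + ∂φ_i (x_i)`, `1 ≤ i ≤ m`, where `x_0 = x_m`. -/
def viSolutions : Set (PiLp 2 H) :=
  {x | ∀ i, N.b i ∈ {x i - N.W i (x (prev i))} + subdifferential (N.φ i) (x i)}

/-- The tuple `(T_1 x, (T_2 ∘ T_1) x, …, (T_{m-1} ∘ ⋯ ∘ T_1) x, x)`. -/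
def orbit (x : H (Fin.last n)) : PiLp 2 H :=
  WithLp.toLp 2 (fun i => Fin.lastCases (motive := H) x
    (fun j : Fin n => chainFromZero N.T j.castSucc x) i)

/-- The operator `Id - W ∘ S` on `H_1 ⊕ ⋯ ⊕ H_m`. -/
def idSubWS (x : PiLp 2 H) : PiLp 2 H := x - N.bigW (shift H x)

end Network

@[simp] theorem shift_apply {n : ℕ} {H : Fin (n + 1) → Type*} [∀ i, NormedAddCommGroup (H i)]
    [∀ i, InnerProductSpace ℝ (H i)] (x : PiLp 2 H) (i : Fin (n + 1)) :
    shift H x i = x (prev i) := rfl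

@[simp] theorem Network.bigW_apply {n : ℕ} {H : Fin (n + 1) → Type*}
    [∀ i, NormedAddCommGroup (H i)] [∀ i, InnerProductSpace ℝ (H i)] (N : Network n H)
    (x : PiLp 2 (fun i => H (prev i))) (i : Fin (n + 1)) :
    N.bigW x i = N.W i (x i) := rfl

end VINet

end

noncomputable section

namespace VINet

open Filter Topology

/-! ### Functions in `Γ₀`, their subgradients and proximity operators. -/

section Gamma0

variable {E : Type*} [NormedAddCommGroup E] [InnerProductSpace ℝ E] {f : E → EReal}

/-! Put C = Id - W∘S. Since p = prox_f(x) exactly when x - p ∈ ∂f(p), and since the subdifferential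
of a separable sum acts coordinatewise, membership in `bigF` is a single inclusion b - C x ∈ ∂φ(x)
on the product space (`mem_bigF_iff`). This yields the descriptions of `bigF` by the variational
inequalities, zeros and fixed points; the description by orbits is the recursion x_i = T_i x_{i-1}
unrolled around the cycle.

Under the averagedness condition, T_m ∘ ⋯ ∘ T_1 is nonexpansive (`norm_Tcomp_sub_le`). Each layer
obeys ‖2(T x - T y) - W(x - y)‖ ≤ ‖W(x - y)‖. Along two trajectories, the vectors inside the
left-hand norm, rescaled by powers of 2, form a tuple admissible in the condition, whose partial
sums are exactly 2^(i-1) W_i applied to the difference of the i-th inputs. The bound on the last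
partial sum is the nonexpansiveness. The fixed point set is then closed and convex, and it is
nonempty when the range is bounded.

Existence rests on Tikhonov regularization: bounded solutions x_n of a monotone inclusion perturbed
by e_n Id, with e_n decreasing to 0, converge in norm (`exists_tendsto_of_regularization`), so
neither weak limits nor subsequences are needed. For a nonexpansive T this is applied to Id - T. For
u ∈ C x + ∂f(x), with C linear and monotone, the perturbed problem is solved by a forward-backward
contraction, and it remains to bound its solutions (`exists_mem_subdifferential_of_bounded`).
Surjectivity of C + ∂φ gives a solution at once; each other sufficient condition is turned into such
an a priori bound. Closedness and convexity of `bigF` come from the closed graph of ∂φ and from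
Minty's lemma. -/

theorem IsGamma0.exists_eq_coe (hf : IsGamma0 f) {x : E} (hx : f x ≠ ⊤) :
    ∃ r : ℝ, f x = r :=
  ⟨(f x).toReal, (EReal.coe_toReal hx (hf.ne_bot x)).symm⟩

theorem IsGamma0.exists_eq_coe_of_le (hf : IsGamma0 f) {x : E} {s : ℝ} (hx : f x ≤ s) :
    ∃ r : ℝ, f x = r :=
  hf.exists_eq_coe (ne_top_of_le_ne_top (EReal.coe_ne_top s) hx)

theorem IsGamma0.exists_point (hf : IsGamma0 f) : ∃ (x : E) (r : ℝ), f x = r := by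
  obtain ⟨x, hx⟩ := hf.dom_nonempty
  exact ⟨x, hf.exists_eq_coe (ne_of_lt hx)⟩

theorem IsGamma0.combo_le (hf : IsGamma0 f) {x y : E} {r s a b : ℝ} (hx : f x ≤ r) (hy : f y ≤ s)
    (ha : 0 ≤ a) (hb : 0 ≤ b) (hab : a + b = 1) :
    f (a • x + b • y) ≤ ((a * r + b * s : ℝ) : EReal) :=
  hf.convex_epigraph (x := (x, r)) hx (y := (y, s)) hy ha hb hab

/-- Closedness of the epigraph; the real majorants `r n` spare any claim about convergence of `f (x
n)`. -/
theorem le_of_tendsto_of_lsc {E : Type*} [TopologicalSpace E] {f : E → EReal} (hf : LowerSemicontinuous f) {x : ℕ → E} {p : E} {r : ℕ → ℝ}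
    {s : ℝ} (hx : Tendsto x atTop (𝓝 p)) (hr : Tendsto r atTop (𝓝 s))
    (h : ∀ n, f (x n) ≤ r n) : f p ≤ s := by
  have h1 : Tendsto (fun n => (x n, (r n : EReal))) atTop (𝓝 (p, (s : EReal))) :=
    hx.prodMk_nhds (EReal.tendsto_coe.2 hr)
  exact hf.isClosed_epigraph.mem_of_tendsto h1 (Eventually.of_forall h)

/-- On `Γ₀`, a subgradient can be described through real numbers only. -/
theorem mem_subdifferential_iff (hf : IsGamma0 f) {x u : E} :
    u ∈ subdifferential f x ↔
      ∃ r : ℝ, f x = r ∧ ∀ (y : E) (s : ℝ), f y = s → inner ℝ (y - x) u + r ≤ s := by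
  constructor
  · intro h
    obtain ⟨y, s, hy⟩ := hf.exists_point
    have hx : f x ≠ ⊤ := by
      intro hx
      have := h y
      rw [hx, EReal.coe_add_top, hy] at this
      exact EReal.coe_ne_top s (top_le_iff.1 this)
    obtain ⟨r, hr⟩ := hf.exists_eq_coe hx
    refine ⟨r, hr, fun y s hs => ?_⟩
    have := h y
    rw [hr, hs] at this
    exact_mod_cast this
  · rintro ⟨r, hr, h⟩ y
    by_cases hy : f y = ⊤
    · rw [hy]; exact le_top
    · obtain ⟨s, hs⟩ := hf.exists_eq_coe hy
      rw [hr, hs]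
      exact_mod_cast h y s hs

theorem subdifferential_monotone (hf : IsGamma0 f) : IsMonotoneOp (subdifferential f) := by
  intro x y u hu v hv
  obtain ⟨r, hr, h⟩ := (mem_subdifferential_iff hf).1 hu
  obtain ⟨s, hs, h'⟩ := (mem_subdifferential_iff hf).1 hv
  have h1 := h y s hs
  have h2 := h' x r hr
  simp only [inner_sub_left, inner_sub_right] at *
  linarith

/-- The subgradient inequality at a fixed test point passes to the limit: the inner product is
continuous and `f` is lower semicontinuous. A test point of finite value also shows that `f p` is
finite. -/
theorem mem_subdifferential_of_tendsto (hf : IsGamma0 f) {x u : ℕ → E} {p q : E}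
    (hx : Tendsto x atTop (𝓝 p)) (hu : Tendsto u atTop (𝓝 q))
    (h : ∀ n, u n ∈ subdifferential f (x n)) : q ∈ subdifferential f p := by
  have key : ∀ (y : E) (s : ℝ), f y = s → f p ≤ ((s - inner ℝ (y - p) q : ℝ) : EReal) := by
    intro y s hs
    refine le_of_tendsto_of_lsc hf.lsc hx (r := fun n => s - inner ℝ (y - x n) (u n)) ?_ ?_
    · exact tendsto_const_nhds.sub ((tendsto_const_nhds.sub hx).inner hu)
    · intro n
      obtain ⟨r, hr, h'⟩ := (mem_subdifferential_iff hf).1 (h n)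
      rw [hr]
      have := h' y s hs
      exact_mod_cast (by linarith)
  obtain ⟨y, s, hy⟩ := hf.exists_point
  obtain ⟨r, hr⟩ := hf.exists_eq_coe_of_le (key y s hy)
  refine (mem_subdifferential_iff hf).2 ⟨r, hr, fun z t ht => ?_⟩
  have := key z t ht
  rw [hr] at this
  have : r ≤ t - inner ℝ (z - p) q := by exact_mod_cast this
  linarith

/-- Isolates the first-order term of a perturbation of size `t`, after division by `t`. -/
theorem nonpos_of_forall_le_mul {a b : ℝ} (h : ∀ t : ℝ, 0 < t → t ≤ 1 → a ≤ t * b) : a ≤ 0 := by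
  have h1 : Tendsto (fun t : ℝ => t * b) (𝓝[>] 0) (𝓝 0) := by
    have : Tendsto (fun t : ℝ => t * b) (𝓝 0) (𝓝 (0 * b)) :=
      (continuous_id.mul continuous_const).tendsto 0
    rw [zero_mul] at this
    exact this.mono_left nhdsWithin_le_nhds
  refine ge_of_tendsto h1 ?_
  filter_upwards [Ioc_mem_nhdsGT (zero_lt_one' ℝ)] with t ht
  exact h t ht.1 ht.2

/-- Fermat's rule for the sum of a function in `Γ₀` and a multiple of a squared distance. -/
theorem smul_sub_mem_subdifferential_of_minimizer (hf : IsGamma0 f) {c r : ℝ} {z p : E}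
    (hp : f p = r)
    (h : ∀ (y : E) (s : ℝ), f y ≤ s → r + c / 2 * ‖z - p‖ ^ 2 ≤ s + c / 2 * ‖z - y‖ ^ 2) :
    c • (z - p) ∈ subdifferential f p := by
  refine (mem_subdifferential_iff hf).2 ⟨r, hp, fun y s hs => ?_⟩
  have : inner ℝ (y - p) (c • (z - p)) + r - s ≤ 0 := by
    refine nonpos_of_forall_le_mul (b := c / 2 * ‖y - p‖ ^ 2) fun t ht ht1 => ?_
    have h1 := h _ _ (hf.combo_le hp.le hs.le (sub_nonneg.2 ht1) ht.le (by ring : 1 - t + t = 1))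
    have h2 : z - ((1 - t) • p + t • y) = (z - p) - t • (y - p) := by module
    rw [h2, norm_sub_sq_real (z - p) (t • (y - p)), norm_smul, real_inner_smul_right, mul_pow, Real.norm_eq_abs,
      sq_abs, real_inner_comm] at h1
    rw [real_inner_smul_right]
    refine le_of_mul_le_mul_left ?_ ht
    linarith
  linarith

/-- The proximal subproblem has a solution when the function is bounded below. -/
theorem exists_smul_sub_mem_subdifferential [CompleteSpace E] (hf : IsGamma0 f)
    {l : ℝ} (hl : ∀ x, (l : EReal) ≤ f x) {c : ℝ} (hc : 0 < c) (z : E) :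
    ∃ p, c • (z - p) ∈ subdifferential f p := by
  let S : Set ℝ := {v | ∃ (y : E) (s : ℝ), f y ≤ s ∧ v = s + c / 2 * ‖z - y‖ ^ 2}
  have hSne : S.Nonempty := by
    obtain ⟨y, s, hy⟩ := hf.exists_point
    exact ⟨_, y, s, hy.le, rfl⟩
  have hSbdd : BddBelow S := by
    refine ⟨l, ?_⟩
    rintro _ ⟨y, s, hy, rfl⟩
    have h1 : l ≤ s := by exact_mod_cast (hl y).trans hy
    have : 0 ≤ c / 2 * ‖z - y‖ ^ 2 := by positivity
    linarith
  set m := sInf S with hm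
  have hmin : ∀ (y : E) (s : ℝ), f y ≤ s → m ≤ s + c / 2 * ‖z - y‖ ^ 2 :=
    fun y s hy => csInf_le hSbdd ⟨y, s, hy, rfl⟩
  have hseq : ∀ n : ℕ, ∃ (y : E) (s : ℝ), f y ≤ s ∧
      s + c / 2 * ‖z - y‖ ^ 2 < m + 1 / ((n : ℝ) + 1) := by
    intro n
    obtain ⟨_, ⟨y, s, hy, rfl⟩, h⟩ := exists_lt_of_csInf_lt hSne
      (lt_add_of_pos_right m (Nat.one_div_pos_of_nat (α := ℝ) (n := n)))
    exact ⟨y, s, hy, h⟩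
  choose y s hys hlt using hseq
  -- The objective at the midpoint is at least `m`; by convexity and the parallelogram law it is at
  -- most m + 1/(N+1) - (c/8)‖y n - y k‖². Hence the constant 8/c.
  have hdist : ∀ n k N : ℕ, N ≤ n → N ≤ k →
      dist (y n) (y k) ≤ √(8 / c * (1 / ((N : ℝ) + 1))) := by
    intro n k N hn hk
    have h1 := hmin _ _ (hf.combo_le (hys n) (hys k) (by norm_num : (0 : ℝ) ≤ 1 / 2)
      (by norm_num : (0 : ℝ) ≤ 1 / 2) (by norm_num))
    have h2 : z - ((1 / 2 : ℝ) • y n + (1 / 2 : ℝ) • y k)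
        = (1 / 2 : ℝ) • ((z - y n) + (z - y k)) := by module
    have h3 := parallelogram_law_with_norm ℝ (z - y n) (z - y k)
    have h4 : (z - y n) - (z - y k) = y k - y n := by abel
    rw [h4] at h3
    rw [h2, norm_smul, mul_pow, Real.norm_eq_abs, sq_abs] at h1
    have e1 := hlt n
    have e2 := hlt k
    have e3 := Nat.one_div_le_one_div (α := ℝ) hn
    have e4 := Nat.one_div_le_one_div (α := ℝ) hk
    rw [dist_comm, dist_eq_norm]
    refine Real.le_sqrt_of_sq_le ?_
    rw [div_mul_eq_mul_div, le_div_iff₀ hc]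
    have h5 := congrArg (c * ·) h3
    simp only [mul_add] at h5
    linarith
  have hlim0 : Tendsto (fun N : ℕ => √(8 / c * (1 / ((N : ℝ) + 1)))) atTop (𝓝 0) := by
    have := (tendsto_one_div_add_atTop_nhds_zero_nat (𝕜 := ℝ)).const_mul (8 / c)
    rw [mul_zero] at this
    have h := (Real.continuous_sqrt.tendsto 0).comp this
    rw [Real.sqrt_zero] at h
    exact h
  obtain ⟨p, hp⟩ := cauchySeq_tendsto_of_complete (cauchySeq_of_le_tendsto_0 _ hdist hlim0)
  have hfp : f p ≤ ((m - c / 2 * ‖z - p‖ ^ 2 : ℝ) : EReal) := by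
    refine le_of_tendsto_of_lsc hf.lsc hp
      (r := fun n : ℕ => m + 1 / ((n : ℝ) + 1) - c / 2 * ‖z - y n‖ ^ 2) ?_ ?_
    · have h1 : Tendsto (fun n : ℕ => m + 1 / ((n : ℝ) + 1)) atTop (𝓝 (m + 0)) :=
        (tendsto_one_div_add_atTop_nhds_zero_nat (𝕜 := ℝ)).const_add m
      rw [add_zero] at h1
      exact h1.sub (((tendsto_const_nhds.sub hp).norm.pow 2).const_mul _)
    · intro n
      have := hlt n
      exact (hys n).trans (EReal.coe_le_coe_iff.2 (by linarith))
  obtain ⟨r, hr⟩ := hf.exists_eq_coe_of_le hfp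
  refine ⟨p, smul_sub_mem_subdifferential_of_minimizer hf hr fun w t hw => ?_⟩
  have h1 : r ≤ m - c / 2 * ‖z - p‖ ^ 2 := by rw [hr] at hfp; exact_mod_cast hfp
  linarith [hmin w t hw]

theorem isProxPoint_iff (hf : IsGamma0 f) {x p : E} :
    IsProxPoint f x p ↔ x - p ∈ subdifferential f p := by
  constructor
  · intro h
    obtain ⟨y, s, hy⟩ := hf.exists_point
    have hp : f p ≠ ⊤ := by
      intro hp
      have := h y
      rw [hp, EReal.top_add_coe, hy] at this
      exact EReal.coe_ne_top _ (top_le_iff.1 (this.trans_eq (EReal.coe_add _ _).symm))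
    obtain ⟨r, hr⟩ := hf.exists_eq_coe hp
    have := smul_sub_mem_subdifferential_of_minimizer hf (c := 1) (z := x) hr ?_
    · rwa [one_smul] at this
    · intro w t hw
      obtain ⟨t', ht'⟩ := hf.exists_eq_coe_of_le hw
      have h1 := h w
      rw [ht'] at hw
      have h2 : t' ≤ t := by exact_mod_cast hw
      rw [hr, ht'] at h1
      have h3 : r + ‖x - p‖ ^ 2 / 2 ≤ t' + ‖x - w‖ ^ 2 / 2 := by exact_mod_cast h1
      linarith
  · intro h y
    obtain ⟨r, hr, h⟩ := (mem_subdifferential_iff hf).1 h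
    by_cases hy : f y = ⊤
    · rw [hy, EReal.top_add_coe]; exact le_top
    obtain ⟨s, hs⟩ := hf.exists_eq_coe hy
    have h1 := h y s hs
    rw [hr, hs]
    have h2 : x - y = (x - p) - (y - p) := by abel
    have h3 := norm_sub_sq_real (x - p) (y - p)
    rw [← h2, real_inner_comm] at h3
    have h4 := sq_nonneg ‖y - p‖
    exact_mod_cast (by linarith : r + ‖x - p‖ ^ 2 / 2 ≤ s + ‖x - y‖ ^ 2 / 2)

/-- The reflected resolvent of a subdifferential is nonexpansive. -/
theorem norm_reflection_le (hf : IsGamma0 f) {x y p q : E} (hp : x - p ∈ subdifferential f p)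
    (hq : y - q ∈ subdifferential f q) : ‖(2 : ℝ) • (p - q) - (x - y)‖ ≤ ‖x - y‖ := by
  have h := subdifferential_monotone hf _ _ _ hp _ hq
  have h1 : (x - p) - (y - q) = (x - y) - (p - q) := by abel
  rw [h1, inner_sub_right, real_inner_self_eq_norm_sq] at h
  refine abs_le_of_sq_le_sq' ?_ (norm_nonneg _) |>.2
  rw [norm_sub_sq_real, norm_smul, real_inner_smul_left, mul_pow, Real.norm_eq_abs, sq_abs]
  linarith

/-- Nonexpansiveness of the resolvent with step size 1/c, from monotonicity and Cauchy–Schwarz. -/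
theorem norm_sub_le_of_smul_mem (hf : IsGamma0 f) {c : ℝ} (hc : 0 < c) {x y p q : E}
    (hp : c • (x - p) ∈ subdifferential f p)
    (hq : c • (y - q) ∈ subdifferential f q) : ‖p - q‖ ≤ ‖x - y‖ := by
  have h := subdifferential_monotone hf _ _ _ hp _ hq
  have h1 : c • (x - p) - c • (y - q) = c • ((x - y) - (p - q)) := by module
  rw [h1, real_inner_smul_right, inner_sub_right, real_inner_self_eq_norm_sq] at h
  have h2 := nonneg_of_mul_nonneg_right h hc
  have h3 := real_inner_le_norm (p - q) (x - y)
  by_contra! h4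
  nlinarith [norm_nonneg (p - q), norm_nonneg (x - y)]

/-- Existence of a proximal point is a hypothesis, instead of a lower bound on `f`, so that the
result also covers `bigψ`, whose linear term may make it unbounded below. -/
theorem prox_eq_iff (hf : IsGamma0 f) {x p : E} (hex : ∃ q, x - q ∈ subdifferential f q) :
    prox f x = p ↔ x - p ∈ subdifferential f p := by
  have h0 : x - prox f x ∈ subdifferential f (prox f x) := by
    obtain ⟨q, hq⟩ := hex
    exact (isProxPoint_iff hf).1 (Classical.epsilon_spec ⟨q, (isProxPoint_iff hf).2 hq⟩)
  refine ⟨fun h => h ▸ h0, fun h => ?_⟩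
  have := norm_sub_le_of_smul_mem hf one_pos (x := x) (y := x) (p := prox f x) (q := p)
    (by rwa [one_smul]) (by rwa [one_smul])
  rw [sub_self, norm_zero] at this
  exact sub_eq_zero.1 (norm_le_zero_iff.1 this)

theorem exists_sub_mem_subdifferential [CompleteSpace E] (hf : IsGamma0 f)
    {l : ℝ} (hl : ∀ x, (l : EReal) ≤ f x) (z : E) : ∃ p, z - p ∈ subdifferential f p := by
  simpa only [one_smul] using exists_smul_sub_mem_subdifferential hf hl one_pos z

/-- Subtracting a linear form keeps a function in `Γ₀`. -/
theorem IsGamma0.sub_inner (hf : IsGamma0 f) (b : E) :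
    IsGamma0 (fun x => f x - ((inner ℝ x b : ℝ) : EReal)) := by
  have hle : ∀ (x : E) (r : ℝ), f x - ((inner ℝ x b : ℝ) : EReal) ≤ r ↔
      f x ≤ ((r + inner ℝ x b : ℝ) : EReal) := by
    intro x r
    rw [EReal.sub_le_iff_le_add (Or.inl (EReal.coe_ne_bot _)) (Or.inl (EReal.coe_ne_top _)),
      EReal.coe_add]
  refine ⟨fun x => ?_, ?_, ?_, ?_⟩
  · rw [sub_eq_add_neg, ← EReal.coe_neg, EReal.add_ne_bot_iff]
    exact ⟨hf.ne_bot x, EReal.coe_ne_bot _⟩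
  · obtain ⟨x, r, hr⟩ := hf.exists_point
    refine ⟨x, ?_⟩
    change f x - _ < ⊤
    rw [hr, ← EReal.coe_sub]
    exact EReal.coe_lt_top _
  · simp_rw [sub_eq_add_neg, ← EReal.coe_neg]
    refine hf.lsc.add' ?_ fun x => EReal.continuousAt_add (Or.inr (EReal.coe_ne_bot _))
      (Or.inr (EReal.coe_ne_top _))
    exact Continuous.lowerSemicontinuous
      (continuous_coe_real_ereal.comp (continuous_id.inner continuous_const).neg)
  · rintro ⟨x, r⟩ hx ⟨y, s⟩ hy a c ha hc hac
    have hx' := (hle x r).1 hx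
    have hy' := (hle y s).1 hy
    refine (hle _ _).2 ((hf.combo_le hx' hy' ha hc hac).trans (le_of_eq ?_))
    congr 1
    simp only [Prod.fst_add, Prod.smul_fst, Prod.snd_add, Prod.smul_snd, smul_eq_mul,
      inner_add_left, real_inner_smul_left]
    ring

theorem mem_subdifferential_sub_inner_iff (hf : IsGamma0 f) {b x u : E} :
    u ∈ subdifferential (fun x => f x - ((inner ℝ x b : ℝ) : EReal)) x ↔
      u + b ∈ subdifferential f x := by
  have heq : ∀ (x : E) (r : ℝ), f x - ((inner ℝ x b : ℝ) : EReal) = r ↔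
      f x = ((r + inner ℝ x b : ℝ) : EReal) := by
    intro x r
    constructor
    · intro h
      rw [EReal.coe_add, ← h, EReal.sub_add_cancel]
    · intro h
      rw [h, EReal.coe_add, EReal.add_sub_cancel_right]
  rw [mem_subdifferential_iff (hf.sub_inner b), mem_subdifferential_iff hf]
  constructor
  · rintro ⟨r, hr, h⟩
    refine ⟨_, (heq x r).1 hr, fun y s hs => ?_⟩
    have := h y (s - inner ℝ y b) ((heq _ _).2 (by rw [hs, sub_add_cancel]))
    rw [inner_add_right, inner_sub_left y x b]
    linarith
  · rintro ⟨r, hr, h⟩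
    refine ⟨r - inner ℝ x b, (heq _ _).2 (by rw [hr, sub_add_cancel]), fun y s hs => ?_⟩
    have := h y _ ((heq _ _).1 hs)
    rw [inner_add_right, inner_sub_left y x b] at this
    linarith

end Gamma0

/-! ### Strong convergence of Tikhonov curves. -/

section Regularization

variable {E : Type*} [NormedAddCommGroup E] [InnerProductSpace ℝ E]

/-- A bounded Tikhonov curve of a monotone operator converges strongly. -/
theorem exists_tendsto_of_regularization [CompleteSpace E] {x : ℕ → E} {e : ℕ → ℝ}
    (he : ∀ n, 0 < e n) (hanti : Antitone e) {R : ℝ} (hR : ∀ n, ‖x n‖ ≤ R)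
    (h : ∀ n k, 0 ≤ inner ℝ (x n - x k) (e k • x k - e n • x n)) :
    ∃ p, Tendsto x atTop (𝓝 p) := by
  -- Expanding `h` gives (e n + e k)‖x n - x k‖² ≤ (e n - e k)(‖x k‖² - ‖x n‖²). If the last factor
  -- is negative, the right side is nonpositive and the two points coincide; otherwise e n - e k ≤ e
  -- n + e k concludes. So the norms increase, and being bounded they control the Cauchy
  -- differences.
  have key : ∀ n k, n ≤ k → ‖x n - x k‖ ^ 2 ≤ ‖x k‖ ^ 2 - ‖x n‖ ^ 2 := by
    intro n k hnk
    have h1 := h n k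
    have h2 := norm_sub_sq_real (x n) (x k)
    simp only [inner_sub_left, inner_sub_right, real_inner_smul_right,
      real_inner_self_eq_norm_sq, real_inner_comm (x n) (x k)] at h1
    have h3 := hanti hnk
    have h4 : (e n + e k) * ‖x n - x k‖ ^ 2 ≤ (e n - e k) * (‖x k‖ ^ 2 - ‖x n‖ ^ 2) := by
      rw [h2]; linarith
    have hk := he k
    have hn := he n
    rcases le_or_gt 0 (‖x k‖ ^ 2 - ‖x n‖ ^ 2) with h5 | h5
    · refine le_of_mul_le_mul_left (h4.trans ?_) (add_pos hn hk)
      exact mul_le_mul_of_nonneg_right (by linarith) h5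
    · have h6 := mul_nonpos_of_nonneg_of_nonpos (sub_nonneg.2 h3) h5.le
      have h7 : ‖x n - x k‖ ^ 2 ≤ 0 := nonpos_of_mul_nonpos_right (h4.trans h6) (add_pos hn hk)
      have h8 := pow_eq_zero_iff two_ne_zero |>.1 (le_antisymm h7 (sq_nonneg _))
      rw [sub_eq_zero.1 (norm_eq_zero.1 h8)]
      simp
  have hmono : Monotone fun n => ‖x n‖ ^ 2 := fun n k hnk => by
    have := key n k hnk
    have := sq_nonneg ‖x n - x k‖
    dsimp only
    linarith
  have hbdd : BddAbove (Set.range fun n => ‖x n‖ ^ 2) := by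
    refine ⟨R ^ 2, ?_⟩
    rintro _ ⟨n, rfl⟩
    exact pow_le_pow_left₀ (norm_nonneg _) (hR n) 2
  set L := ⨆ n, ‖x n‖ ^ 2
  have hlim : Tendsto (fun n => ‖x n‖ ^ 2) atTop (𝓝 L) := tendsto_atTop_ciSup hmono hbdd
  have hb : Tendsto (fun n => √(L - ‖x n‖ ^ 2)) atTop (𝓝 0) := by
    have := hlim.const_sub L
    rw [sub_self] at this
    have h := (Real.continuous_sqrt.tendsto 0).comp this
    rw [Real.sqrt_zero] at h
    exact h
  refine cauchySeq_tendsto_of_complete (cauchySeq_of_le_tendsto_0' _ (fun n k hnk => ?_) hb)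
  rw [dist_eq_norm]
  refine Real.le_sqrt_of_sq_le ((key n k hnk).trans ?_)
  exact sub_le_sub_right (le_ciSup hbdd k) _

theorem regularization_pos (n : ℕ) : (0 : ℝ) < 1 / ((n : ℝ) + 1) := Nat.one_div_pos_of_nat

theorem regularization_le_one (n : ℕ) : 1 / ((n : ℝ) + 1) ≤ 1 := by
  rw [div_le_one (by positivity)]
  have : (0 : ℝ) ≤ n := n.cast_nonneg
  linarith

theorem regularization_antitone : Antitone fun n : ℕ => 1 / ((n : ℝ) + 1) :=
  fun _ _ h => Nat.one_div_le_one_div h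

end Regularization

/-! ### Fixed points of nonexpansive maps. -/

section Nonexpansive

variable {E : Type*} [NormedAddCommGroup E] [InnerProductSpace ℝ E] {T : E → E}

theorem convex_fixedPoints_of_nonexpansive (hT : ∀ x y, ‖T x - T y‖ ≤ ‖x - y‖) :
    Convex ℝ (Function.fixedPoints T) := by
  intro x hx y hy a b ha hb hab
  have hx : T x = x := hx
  have hy : T y = y := hy
  set z := a • x + b • y with hz
  obtain rfl : a = 1 - b := by linarith
  have h1 : ‖T z - x‖ ≤ b * ‖y - x‖ := by
    have h := hT z x
    rw [hx] at h
    have e : z - x = b • (y - x) := by rw [hz]; module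
    rwa [e, norm_smul, Real.norm_of_nonneg hb] at h
  have h2 : ‖T z - y‖ ≤ (1 - b) * ‖y - x‖ := by
    have h := hT z y
    rw [hy] at h
    have e : z - y = (1 - b) • (x - y) := by rw [hz]; module
    rwa [e, norm_smul, Real.norm_of_nonneg ha, norm_sub_rev x y] at h
  have h1' := mul_le_mul_of_nonneg_left (pow_le_pow_left₀ (norm_nonneg _) h1 2) ha
  have h2' := mul_le_mul_of_nonneg_left (pow_le_pow_left₀ (norm_nonneg _) h2 2) hb
  have e1 : T z - z = (1 - b) • (T z - x) + b • (T z - y) := by rw [hz]; module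
  have e2 : y - x = (T z - x) - (T z - y) := by abel
  have h3 := norm_sub_sq_real (T z - x) (T z - y)
  rw [← e2] at h3
  -- For p = T z - x and q = T z - y, ‖(1-b)p + bq‖² = (1-b)‖p‖² + b‖q‖² - b(1-b)‖p - q‖². Inserting
  -- the bounds on ‖p‖ and ‖q‖ makes everything cancel.
  have h4 : ‖T z - z‖ ^ 2 ≤ 0 := by
    rw [e1, norm_add_sq_real, norm_smul, norm_smul, real_inner_smul_left, real_inner_smul_right,
      mul_pow, mul_pow, Real.norm_eq_abs, Real.norm_eq_abs, sq_abs, sq_abs]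
    linear_combination h1' + h2' + ((1 - b) * b) * h3
  have h5 : ‖T z - z‖ = 0 := by
    have := sq_nonneg ‖T z - z‖
    exact pow_eq_zero_iff (two_ne_zero) |>.1 (le_antisymm h4 this)
  exact sub_eq_zero.1 (norm_eq_zero.1 h5)

theorem isClosed_fixedPoints_of_nonexpansive {E : Type*} [NormedAddCommGroup E] {T : E → E}
    (hT : ∀ x y, ‖T x - T y‖ ≤ ‖x - y‖) :
    IsClosed (Function.fixedPoints T) :=
  isClosed_fixedPoints (LipschitzWith.of_dist_le_mul (K := 1) fun x y => by
    simpa [dist_eq_norm] using hT x y).continuous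

/-- A nonexpansive operator with bounded range on a Hilbert space has a fixed point. -/
theorem nonempty_fixedPoints_of_nonexpansive [CompleteSpace E]
    (hT : ∀ x y, ‖T x - T y‖ ≤ ‖x - y‖) (hb : Bornology.IsBounded (Set.range T)) :
    (Function.fixedPoints T).Nonempty := by
  obtain ⟨R, hR⟩ := hb.exists_norm_le
  have hR : ∀ x, ‖T x‖ ≤ R := fun x => hR _ ⟨x, rfl⟩
  -- The fixed point of the contraction (1+e)⁻¹ T satisfies e x + (x - T x) = 0, the Tikhonov
  -- perturbation of the monotone operator Id - T.
  have hex : ∀ n : ℕ, ∃ x, T x = (1 + 1 / ((n : ℝ) + 1)) • x := by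
    intro n
    set e : ℝ := 1 / ((n : ℝ) + 1)
    have he : 0 < e := regularization_pos n
    have hK : 0 ≤ (1 + e)⁻¹ := by positivity
    have hc : ContractingWith ⟨(1 + e)⁻¹, hK⟩ fun x => (1 + e)⁻¹ • T x := by
      refine ⟨?_, LipschitzWith.of_dist_le_mul fun x y => ?_⟩
      · change (1 + e)⁻¹ < 1
        exact inv_lt_one_of_one_lt₀ (by linarith)
      · rw [dist_eq_norm, dist_eq_norm, ← smul_sub, norm_smul, Real.norm_of_nonneg hK]
        exact mul_le_mul_of_nonneg_left (hT x y) hK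
    have hfix := hc.fixedPoint_isFixedPt
    refine ⟨hc.fixedPoint, ?_⟩
    conv_rhs => rw [← hfix.eq]
    rw [smul_inv_smul₀ (by positivity)]
  choose x hx using hex
  suffices h : ∃ p, Tendsto x atTop (𝓝 p) by
    obtain ⟨p, hp⟩ := h
    refine ⟨p, tendsto_nhds_unique (f := fun n => T (x n)) (l := atTop) ?_ ?_⟩
    · exact ((LipschitzWith.of_dist_le_mul (K := 1) fun x y => by
        simpa [dist_eq_norm] using hT x y).continuous.tendsto p).comp hp
    · simp_rw [hx]
      have := (((tendsto_one_div_add_atTop_nhds_zero_nat (𝕜 := ℝ)).const_add 1).smul hp)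
      simpa only [add_zero, one_smul] using this
  refine exists_tendsto_of_regularization (x := x) regularization_pos
    regularization_antitone (R := R) (fun n => ?_) fun n k => ?_
  · have h1 := hR (x n)
    have h2 := regularization_pos n
    rw [hx n, norm_smul, Real.norm_of_nonneg (by linarith)] at h1
    nlinarith [norm_nonneg (x n)]
  · have h1 := hT (x n) (x k)
    have h2 := real_inner_le_norm (x n - x k) (T (x n) - T (x k))
    have h3 : (1 / ((k : ℝ) + 1)) • x k - (1 / ((n : ℝ) + 1)) • x n
        = (x n - x k) - (T (x n) - T (x k)) := by rw [hx, hx]; module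
    rw [h3, inner_sub_right, real_inner_self_eq_norm_sq]
    nlinarith [norm_nonneg (x n - x k)]

end Nonexpansive

/-! ### The inclusion u ∈ C x + ∂f(x) with a monotone bounded linear C. -/

section Inclusion

variable {E : Type*} [NormedAddCommGroup E] [InnerProductSpace ℝ E] {f : E → EReal}
  {C : E →L[ℝ] E}

/-- The solutions are the fixed points of the forward-backward map x ↦ J(x - g(C x - u)), where J is
the resolvent of ∂f with step g; strong monotonicity makes the forward step a strict contraction. -/
theorem exists_mem_subdifferential_of_stronglyMonotone [CompleteSpace E] (hf : IsGamma0 f)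
    {l : ℝ} (hl : ∀ x, (l : EReal) ≤ f x) {e : ℝ} (he : 0 < e)
    (hC : ∀ x, e * ‖x‖ ^ 2 ≤ inner ℝ x (C x)) (u : E) :
    ∃ x, u - C x ∈ subdifferential f x := by
  -- Adding `e` ensures L > 0 and e ≤ L. The step g = e/L² minimizes the squared factor 1 - 2ge +
  -- g²L², with value 1 - e²/L² in [0, 1).
  set L := ‖C‖ + e with hL
  have hLpos : 0 < L := by positivity
  set g := e / L ^ 2 with hg
  have hgpos : 0 < g := by positivity
  choose J hJ using fun z => exists_smul_sub_mem_subdifferential hf hl (inv_pos.2 hgpos) z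
  have hbound : ∀ x, ‖x - g • C x‖ ^ 2 ≤ (1 - e ^ 2 / L ^ 2) * ‖x‖ ^ 2 := by
    intro x
    rw [norm_sub_sq_real, norm_smul, real_inner_smul_right, mul_pow, Real.norm_eq_abs, sq_abs]
    have h1 : ‖C x‖ ^ 2 ≤ L ^ 2 * ‖x‖ ^ 2 := by
      rw [← mul_pow]
      refine pow_le_pow_left₀ (norm_nonneg _) ((C.le_opNorm x).trans ?_) 2
      exact mul_le_mul_of_nonneg_right (by linarith) (norm_nonneg _)
    have h2 := mul_le_mul_of_nonneg_left h1 (sq_nonneg g)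
    have h3 := mul_le_mul_of_nonneg_left (hC x) hgpos.le
    have h4 : g * L ^ 2 = e := by rw [hg]; field_simp
    have h5 : e ^ 2 / L ^ 2 = g * e := by rw [hg]; ring
    have h6 : g ^ 2 * (L ^ 2 * ‖x‖ ^ 2) = g * e * ‖x‖ ^ 2 := by rw [← h4]; ring
    rw [h5]
    linarith
  have hq0 : 0 ≤ 1 - e ^ 2 / L ^ 2 := by
    rw [sub_nonneg, div_le_one (by positivity)]
    exact pow_le_pow_left₀ he.le (by rw [hL]; linarith [norm_nonneg C]) 2
  have hq1 : 1 - e ^ 2 / L ^ 2 < 1 := by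
    have : 0 < e ^ 2 / L ^ 2 := by positivity
    linarith
  set K := √(1 - e ^ 2 / L ^ 2) with hK
  have hK0 : 0 ≤ K := Real.sqrt_nonneg _
  have hK1 : K < 1 := by rw [hK, Real.sqrt_lt' one_pos]; linarith
  have hc : ContractingWith ⟨K, hK0⟩ fun x => J (x - g • (C x - u)) := by
    refine ⟨hK1, LipschitzWith.of_dist_le_mul fun x y => ?_⟩
    rw [dist_eq_norm, dist_eq_norm]
    refine (norm_sub_le_of_smul_mem hf (inv_pos.2 hgpos) (hJ _) (hJ _)).trans ?_
    have h1 : x - g • (C x - u) - (y - g • (C y - u)) = (x - y) - g • C (x - y) := by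
      rw [map_sub]; module
    rw [h1]
    refine abs_le_of_sq_le_sq' ?_ (by positivity) |>.2
    refine (hbound _).trans_eq ?_
    change _ = (K * ‖x - y‖) ^ 2
    rw [mul_pow, hK, Real.sq_sqrt hq0]
  have hfix := hc.fixedPoint_isFixedPt
  refine ⟨hc.fixedPoint, ?_⟩
  have h := hJ (hc.fixedPoint - g • (C hc.fixedPoint - u))
  rw [show J (hc.fixedPoint - g • (C hc.fixedPoint - u)) = hc.fixedPoint from hfix] at h
  have h1 : g⁻¹ • (hc.fixedPoint - g • (C hc.fixedPoint - u) - hc.fixedPoint)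
      = u - C hc.fixedPoint := by
    rw [sub_sub_cancel_left, smul_neg, inv_smul_smul₀ hgpos.ne', neg_sub]
  rwa [h1] at h

/-- If the solutions of the regularized inclusions `u ∈ e x + C x + ∂f x` remain bounded, then
`u ∈ C x + ∂f x` has a solution. -/
theorem exists_mem_subdifferential_of_bounded [CompleteSpace E] (hf : IsGamma0 f)
    {l : ℝ} (hl : ∀ x, (l : EReal) ≤ f x) (hC : ∀ x, 0 ≤ inner ℝ x (C x)) {u : E} {R : ℝ}
    (hR : ∀ (e : ℝ) (x : E), 0 < e → e ≤ 1 → u - (e • x + C x) ∈ subdifferential f x → ‖x‖ ≤ R) :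
    ∃ x, u - C x ∈ subdifferential f x := by
  have hex : ∀ n : ℕ, ∃ x, u - ((1 / ((n : ℝ) + 1)) • x + C x) ∈ subdifferential f x := by
    intro n
    refine exists_mem_subdifferential_of_stronglyMonotone hf hl (regularization_pos n)
      (C := (1 / ((n : ℝ) + 1)) • ContinuousLinearMap.id ℝ E + C) (fun x => ?_) u
    have := hC x
    simp only [add_apply, smul_apply,
      ContinuousLinearMap.id_apply, inner_add_right, real_inner_smul_right,
      real_inner_self_eq_norm_sq]
    linarith
  choose x hx using hex
  suffices h : ∃ p, Tendsto x atTop (𝓝 p) by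
    obtain ⟨p, hp⟩ := h
    refine ⟨p, mem_subdifferential_of_tendsto hf hp ?_ hx⟩
    have h1 := ((tendsto_one_div_add_atTop_nhds_zero_nat (𝕜 := ℝ)).smul hp).add
      ((C.continuous.tendsto p).comp hp)
    rw [zero_smul, zero_add] at h1
    exact tendsto_const_nhds.sub h1
  refine exists_tendsto_of_regularization (x := x) regularization_pos
    regularization_antitone
    (fun n => hR _ _ (regularization_pos n) (regularization_le_one n) (hx n)) fun n k => ?_
  · have h1 := subdifferential_monotone hf _ _ _ (hx n) _ (hx k)
    have h2 := hC (x n - x k)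
    have h3 : u - ((1 / ((n : ℝ) + 1)) • x n + C (x n)) - (u - ((1 / ((k : ℝ) + 1)) • x k + C (x k)))
        = ((1 / ((k : ℝ) + 1)) • x k - (1 / ((n : ℝ) + 1)) • x n) - C (x n - x k) := by
      rw [map_sub]; module
    rw [h3, inner_sub_right] at h1
    linarith

/-- Minty's lemma: the solutions of a monotone variational inequality form a convex set. -/
theorem convex_setOf_sub_mem_subdifferential (hf : IsGamma0 f) (hC : ∀ x, 0 ≤ inner ℝ x (C x))
    (u : E) : Convex ℝ {x | u - C x ∈ subdifferential f x} := by
  -- Evaluating C at the test point `w` instead of at the solution leaves a condition convex in the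
  -- solution, hence inherited by `z`. The original inequality is recovered below by testing at z +
  -- t(w - z) with t → 0.
  have weak : ∀ x, u - C x ∈ subdifferential f x → ∀ (w : E) (s : ℝ), f w = s →
      f x ≤ ((s - inner ℝ (w - x) (u - C w) : ℝ) : EReal) := by
    intro x hx w s hs
    obtain ⟨r, hr, h⟩ := (mem_subdifferential_iff hf).1 hx
    rw [hr, EReal.coe_le_coe_iff]
    have h1 := h w s hs
    have h2 := hC (w - x)
    rw [map_sub] at h2
    simp only [inner_sub_right] at *
    linarith
  intro x hx y hy a b ha hb hab
  set z := a • x + b • y with hz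
  have hweak : ∀ (w : E) (s : ℝ), f w = s →
      f z ≤ ((s - inner ℝ (w - z) (u - C w) : ℝ) : EReal) := by
    intro w s hs
    refine (hf.combo_le (weak x hx w s hs) (weak y hy w s hs) ha hb hab).trans_eq ?_
    congr 1
    have : w - z = a • (w - x) + b • (w - y) := by
      obtain rfl : a = 1 - b := by linarith
      rw [hz]; module
    rw [this, inner_add_left, real_inner_smul_left, real_inner_smul_left]
    linear_combination s * hab
  clear_value z
  obtain ⟨w₀, s₀, h₀⟩ := hf.exists_point
  obtain ⟨r, hr⟩ := hf.exists_eq_coe_of_le (hweak w₀ s₀ h₀)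
  refine (mem_subdifferential_iff hf).2 ⟨r, hr, fun w s hs => ?_⟩
  have : inner ℝ (w - z) (u - C z) + r - s ≤ 0 := by
    refine nonpos_of_forall_le_mul (b := inner ℝ (w - z) (C (w - z))) fun t ht ht1 => ?_
    have hle := hf.combo_le hr.le hs.le (sub_nonneg.2 ht1) ht.le (by ring : 1 - t + t = 1)
    obtain ⟨s', hs'⟩ := hf.exists_eq_coe_of_le hle
    rw [hs', EReal.coe_le_coe_iff] at hle
    have h1 := hweak _ _ hs'
    rw [hr, EReal.coe_le_coe_iff] at h1
    have e1 : (1 - t) • z + t • w = z + t • (w - z) := by module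
    rw [e1, add_sub_cancel_left, map_add, map_smul, real_inner_smul_left, ← sub_sub,
      inner_sub_right (w - z), real_inner_smul_right] at h1
    refine le_of_mul_le_mul_left ?_ ht
    linarith
  linarith

end Inclusion

/-! ### Separable sums on a Hilbert direct sum. -/

theorem ereal_coe_sum {ι : Type*} (s : Finset ι) (r : ι → ℝ) :
    ((∑ i ∈ s, r i : ℝ) : EReal) = ∑ i ∈ s, (r i : EReal) :=
  map_sum (⟨⟨Real.toEReal, EReal.coe_zero⟩, EReal.coe_add⟩ : ℝ →+ EReal) r s

theorem ereal_sum_ne_bot {ι : Type*} (s : Finset ι) {g : ι → EReal} (hg : ∀ i, g i ≠ ⊥) :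
    ∑ i ∈ s, g i ≠ ⊥ := by
  classical
  induction s using Finset.induction_on with
  | empty => simp
  | insert a s ha ih =>
    rw [Finset.sum_insert ha, EReal.add_ne_bot_iff]
    exact ⟨hg a, ih⟩

theorem piLp_norm_le_sum {ι : Type*} [Fintype ι] {H : ι → Type*}
    [∀ i, NormedAddCommGroup (H i)] (x : PiLp 2 H) : ‖x‖ ≤ ∑ i, ‖x i‖ := by
  rw [PiLp.norm_eq_of_L2]
  refine Real.sqrt_le_iff.2 ⟨Finset.sum_nonneg fun i _ => norm_nonneg _, ?_⟩
  exact Finset.sum_sq_le_sq_sum_of_nonneg fun i _ => norm_nonneg _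

section Separable

variable {ι : Type*} [Fintype ι] {H : ι → Type*} [∀ i, NormedAddCommGroup (H i)]
  [∀ i, InnerProductSpace ℝ (H i)] {f : ∀ i, H i → EReal}

/-- The separable sum `x ↦ ∑ i, f i (x i)`. -/
def separableSum (f : ∀ i, H i → EReal) (x : PiLp 2 H) : EReal := ∑ i, f i (x i)

theorem separableSum_eq_coe {ι : Type*} [Fintype ι] {H : ι → Type*}
    [∀ i, NormedAddCommGroup (H i)] {f : ∀ i, H i → EReal} {x : PiLp 2 H} {r : ι → ℝ} (h : ∀ i, f i (x i) = r i) :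
    separableSum f x = ((∑ i, r i : ℝ) : EReal) := by
  rw [separableSum, ereal_coe_sum]
  exact Finset.sum_congr rfl fun i _ => h i

theorem exists_eq_coe_of_separableSum (hf : ∀ i, IsGamma0 (f i)) {x : PiLp 2 H}
    (hx : separableSum f x ≠ ⊤) : ∃ r : ι → ℝ, ∀ i, f i (x i) = r i := by
  classical
  have : ∀ i, f i (x i) ≠ ⊤ := by
    intro i hi
    apply hx
    rw [separableSum, ← Finset.add_sum_erase _ _ (Finset.mem_univ i), hi]
    exact EReal.top_add_of_ne_bot (ereal_sum_ne_bot _ fun j => (hf j).ne_bot _)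
  choose r hr using fun i => (hf i).exists_eq_coe (this i)
  exact ⟨r, hr⟩

theorem isGamma0_separableSum (hf : ∀ i, IsGamma0 (f i)) : IsGamma0 (separableSum f) := by
  classical
  refine ⟨fun x => ereal_sum_ne_bot _ fun i => (hf i).ne_bot _, ?_, ?_, ?_⟩
  · choose x r hr using fun i => (hf i).exists_point
    refine ⟨WithLp.toLp 2 x, ?_⟩
    change separableSum f _ < ⊤
    rw [separableSum_eq_coe (r := r) hr]
    exact EReal.coe_lt_top _
  · have : ∀ s : Finset ι, LowerSemicontinuous fun x : PiLp 2 H => ∑ i ∈ s, f i (x i) := by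
      intro s
      induction s using Finset.induction_on with
      | empty => simpa using lowerSemicontinuous_const
      | insert a s ha ih =>
        simp_rw [Finset.sum_insert ha]
        refine LowerSemicontinuous.add' ?_ ih fun x => EReal.continuousAt_add
          (Or.inr (ereal_sum_ne_bot _ fun j => (hf j).ne_bot _)) (Or.inl ((hf a).ne_bot _))
        exact (hf a).lsc.comp (PiLp.continuous_apply 2 H a)
    exact this Finset.univ
  · rintro ⟨x, r⟩ hx ⟨y, s⟩ hy a b ha hb hab
    have hx : separableSum f x ≤ r := hx
    have hy : separableSum f y ≤ s := hy
    obtain ⟨p, hp⟩ := exists_eq_coe_of_separableSum hf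
      (ne_top_of_le_ne_top (EReal.coe_ne_top _) hx)
    obtain ⟨q, hq⟩ := exists_eq_coe_of_separableSum hf
      (ne_top_of_le_ne_top (EReal.coe_ne_top _) hy)
    rw [separableSum_eq_coe hp, EReal.coe_le_coe_iff] at hx
    rw [separableSum_eq_coe hq, EReal.coe_le_coe_iff] at hy
    change ∑ i, f i (a • x i + b • y i) ≤ ((a * r + b * s : ℝ) : EReal)
    refine (Finset.sum_le_sum fun i _ =>
      (hf i).combo_le (hp i).le (hq i).le ha hb hab).trans ?_
    rw [← ereal_coe_sum, EReal.coe_le_coe_iff, Finset.sum_add_distrib, ← Finset.mul_sum,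
      ← Finset.mul_sum]
    exact add_le_add (mul_le_mul_of_nonneg_left hx ha) (mul_le_mul_of_nonneg_left hy hb)

theorem mem_subdifferential_separableSum_iff (hf : ∀ i, IsGamma0 (f i)) {x u : PiLp 2 H} :
    u ∈ subdifferential (separableSum f) x ↔ ∀ i, u i ∈ subdifferential (f i) (x i) := by
  classical
  rw [mem_subdifferential_iff (isGamma0_separableSum hf)]
  constructor
  · rintro ⟨r, hr, h⟩ i
    obtain ⟨p, hp⟩ := exists_eq_coe_of_separableSum hf (hr ▸ EReal.coe_ne_top r)
    refine (mem_subdifferential_iff (hf i)).2 ⟨p i, hp i, fun y s hs => ?_⟩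
    have hr' : r = ∑ j, p j := EReal.coe_eq_coe_iff.1 (hr.symm.trans (separableSum_eq_coe hp))
    -- The test point differs from `x` only in coordinate `i`, so all other terms cancel.
    have h1 := h (WithLp.toLp 2 (Function.update x.ofLp i y)) (∑ j, Function.update p i s j)
      (separableSum_eq_coe fun j => ?_)
    · rw [PiLp.inner_apply, hr', Finset.sum_update_of_mem (Finset.mem_univ i),
        Finset.sum_eq_single i, ← Finset.add_sum_erase _ _ (Finset.mem_univ i),
        Finset.sdiff_singleton_eq_erase] at h1
      · simp only [PiLp.sub_apply, Function.update_self] at h1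
        linarith
      · intro j _ hj
        simp [Function.update_of_ne hj]
      · simp
    · by_cases hj : j = i
      · subst hj
        simpa using hs
      · simpa [Function.update_of_ne hj] using hp j
  · intro h
    choose p hp h using fun i => (mem_subdifferential_iff (hf i)).1 (h i)
    refine ⟨_, separableSum_eq_coe hp, fun y s hs => ?_⟩
    obtain ⟨q, hq⟩ := exists_eq_coe_of_separableSum hf (hs ▸ EReal.coe_ne_top s)
    obtain rfl : s = ∑ j, q j := EReal.coe_eq_coe_iff.1 (hs.symm.trans (separableSum_eq_coe hq))
    rw [PiLp.inner_apply, ← Finset.sum_add_distrib]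
    exact Finset.sum_le_sum fun i _ => h i _ _ (hq i)

end Separable

/-! ### Compositions along the cycle and the partial sums of the averagedness condition. -/

section Chain

variable {n : ℕ} {H : Fin (n + 1) → Type*}

@[simp] theorem prev_zero (h : 0 < n + 1) : prev (⟨0, h⟩ : Fin (n + 1)) = Fin.last n := rfl

@[simp] theorem prev_succ (k : ℕ) (h : k + 1 < n + 1) :
    prev (⟨k + 1, h⟩ : Fin (n + 1)) = ⟨k, Nat.lt_of_succ_lt h⟩ := rfl

theorem prev_bijective : Function.Bijective (prev : Fin (n + 1) → Fin (n + 1)) := by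
  rw [← Finite.injective_iff_bijective]
  rintro ⟨_ | i, hi⟩ ⟨_ | j, hj⟩ h
  · rfl
  · simp only [prev_zero, prev_succ, Fin.ext_iff, Fin.val_last] at h; omega
  · simp only [prev_zero, prev_succ, Fin.ext_iff, Fin.val_last] at h; omega
  · simp only [prev_succ, Fin.ext_iff] at h ⊢; omega

theorem chain_self (f : ∀ i, H (prev i) → H i) {a : ℕ} (ha : a < n + 1) :
    chain f le_rfl ha = f ⟨a, ha⟩ := by
  rw [chain, Nat.leRec_self]

theorem chain_succ (f : ∀ i, H (prev i) → H i) {a j : ℕ} (h : a ≤ j) (hj : j + 1 < n + 1) :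
    chain f (Nat.le_succ_of_le h) hj = f ⟨j + 1, hj⟩ ∘ chain f h (Nat.lt_of_succ_lt hj) := by
  rw [chain, Nat.leRec_succ _ _ h]
  rfl

theorem chainFromZero_zero (f : ∀ i, H (prev i) → H i) (h : 0 < n + 1) (x : H (Fin.last n)) :
    chainFromZero f ⟨0, h⟩ x = f ⟨0, h⟩ x :=
  congrFun (chain_self f h) x

theorem chainFromZero_succ (f : ∀ i, H (prev i) → H i) {j : ℕ} (hj : j + 1 < n + 1)
    (x : H (Fin.last n)) :
    chainFromZero f ⟨j + 1, hj⟩ x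
      = f ⟨j + 1, hj⟩ (chainFromZero f ⟨j, Nat.lt_of_succ_lt hj⟩ x) :=
  congrFun (chain_succ f (Nat.zero_le j) hj) x

end Chain

section PartialSum

variable {n : ℕ} {H : Fin (n + 1) → Type*} [∀ i, NormedAddCommGroup (H i)]
  [∀ i, InnerProductSpace ℝ (H i)]

/-- The layer `H_j → H_{j+1}`, with its source written without `prev`. -/
def succLayer (W : ∀ i, H (prev i) →L[ℝ] H i) {j : ℕ} (hj : j + 1 < n + 1) :
    H ⟨j, Nat.lt_of_succ_lt hj⟩ →L[ℝ] H ⟨j + 1, hj⟩ :=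
  W ⟨j + 1, hj⟩

/-- The component in `H_j` of a tuple indexed by the sources of the layers. -/
def sourceSucc (x : ∀ k : Fin (n + 1), H (prev k)) {j : ℕ} (hj : j + 1 < n + 1) :
    H ⟨j, Nat.lt_of_succ_lt hj⟩ :=
  x ⟨j + 1, hj⟩

theorem chain_succ_apply (W : ∀ i, H (prev i) →L[ℝ] H i) {a j : ℕ} (h : a ≤ j)
    (hj : j + 1 < n + 1) (x : H (prev ⟨a, lt_of_le_of_lt h (Nat.lt_of_succ_lt hj)⟩)) :
    chain (fun i => ⇑(W i)) (Nat.le_succ_of_le h) hj x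
      = succLayer W hj (chain (fun i => ⇑(W i)) h (Nat.lt_of_succ_lt hj) x) :=
  congrFun (chain_succ (fun i => ⇑(W i)) h hj) x

theorem chain_map_smul (W : ∀ i, H (prev i) →L[ℝ] H i) {a j : ℕ} (h : a ≤ j) (hj : j < n + 1)
    (c : ℝ) (x : H (prev ⟨a, lt_of_le_of_lt h hj⟩)) :
    chain (fun i => ⇑(W i)) h hj (c • x) = c • chain (fun i => ⇑(W i)) h hj x := by
  induction j, h using Nat.le_induction with
  | base => rw [chain_self, map_smul]
  | succ j h ih => rw [chain_succ_apply _ h, chain_succ_apply _ h, ih, map_smul]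

theorem partialSum_zero (W : ∀ i, H (prev i) →L[ℝ] H i) (h : 0 < n + 1) (x : ∀ k, H (prev k)) :
    partialSum W ⟨0, h⟩ x = W ⟨0, h⟩ (x ⟨0, h⟩) := by
  rw [partialSum, Finset.sum_eq_single ⟨0, h⟩]
  · rw [dif_pos le_rfl, chain_self]
  · rintro ⟨k, hk⟩ _ hne
    rw [dif_neg]
    intro h0
    exact hne (Fin.ext (Nat.le_zero.1 h0))
  · simp

theorem partialSum_succ (W : ∀ i, H (prev i) →L[ℝ] H i) {j : ℕ} (hj : j + 1 < n + 1)
    (x : ∀ k, H (prev k)) :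
    partialSum W ⟨j + 1, hj⟩ x
      = succLayer W hj (partialSum W ⟨j, Nat.lt_of_succ_lt hj⟩ x + sourceSucc x hj) := by
  classical
  have key : ∀ k : Fin (n + 1),
      (if h : k.1 ≤ j + 1 then chain (fun i => ⇑(W i)) h hj (x k) else 0)
      = succLayer W hj (if h : k.1 ≤ j then
          chain (fun i => ⇑(W i)) h (Nat.lt_of_succ_lt hj) (x k) else 0)
        + if k = ⟨j + 1, hj⟩ then succLayer W hj (sourceSucc x hj) else 0 := by
    rintro ⟨k, hk⟩
    by_cases h1 : k ≤ j
    · rw [dif_pos (Nat.le_succ_of_le h1), dif_pos h1, if_neg, add_zero, chain_succ_apply _ h1]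
      intro h2
      have := Fin.ext_iff.1 h2
      dsimp only at this
      omega
    · by_cases h2 : k = j + 1
      · subst h2
        rw [dif_pos le_rfl, dif_neg h1, if_pos rfl, map_zero, zero_add, chain_self]
        rfl
      · rw [dif_neg (by dsimp only; omega), dif_neg h1, if_neg, map_zero, add_zero]
        intro h3
        exact h2 (Fin.ext_iff.1 h3)
  rw [partialSum, Finset.sum_congr rfl fun k _ => key k, Finset.sum_add_distrib, ← map_sum,
    Finset.sum_ite_eq' Finset.univ, if_pos (Finset.mem_univ _), map_add]
  rfl

theorem partialSum_smul (W : ∀ i, H (prev i) →L[ℝ] H i) (j : Fin (n + 1)) (c : ℝ)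
    (x : ∀ k, H (prev k)) : partialSum W j (c • x) = c • partialSum W j x := by
  rw [partialSum, partialSum, Finset.smul_sum]
  refine Finset.sum_congr rfl fun k _ => ?_
  split_ifs with h
  · exact chain_map_smul W h _ c _
  · rw [smul_zero]

/-- The averagedness condition bounds the full sum, without normalization of the first vector. -/
theorem AveragednessCondition.norm_partialSum_le {W : ∀ i, H (prev i) →L[ℝ] H i} {α : ℝ}
    (hW : AveragednessCondition W α) (hα : α ≤ 1) (x : ∀ k, H (prev k))
    (hx : ∀ (k : ℕ) (hk : k + 1 < n + 1),
      ‖x ⟨k + 1, hk⟩‖ ≤ ‖partialSum W ⟨k, Nat.lt_of_succ_lt hk⟩ x‖) :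
    2 * ‖partialSum W (Fin.last n) x‖ ≤ 2 ^ (n + 1) * ‖x ⟨0, Nat.succ_pos n⟩‖ := by
  have normalized : ∀ y : ∀ k, H (prev k), ‖y ⟨0, Nat.succ_pos n⟩‖ ≤ 1 →
      (∀ (k : ℕ) (hk : k + 1 < n + 1),
        ‖y ⟨k + 1, hk⟩‖ ≤ ‖partialSum W ⟨k, Nat.lt_of_succ_lt hk⟩ y‖) →
      2 * ‖partialSum W (Fin.last n) y‖ ≤ 2 ^ (n + 1) * ‖y ⟨0, Nat.succ_pos n⟩‖ := by
    intro y hy0 hy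
    have h1 := hW y hy0 hy
    set y₀ : H (Fin.last n) := y ⟨0, Nat.succ_pos n⟩
    -- The reverse triangle inequality moves (1-α)2^m‖y₀‖ to the right, where it merges with
    -- α2^m‖y₀‖ and α disappears.
    have h2 := norm_sub_norm_le (partialSum W (Fin.last n) y) ((2 ^ (n + 1) * (1 - α)) • y₀)
    rw [norm_smul, Real.norm_of_nonneg
      (mul_nonneg (by positivity) (sub_nonneg.2 hα))] at h2
    change _ ≤ 2 ^ (n + 1) * ‖y₀‖
    linarith
  -- All conditions are positively homogeneous; the maximum with 1 makes the scaling valid for a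
  -- zero first vector too.
  set M := max 1 ‖x ⟨0, Nat.succ_pos n⟩‖ with hM
  have hMpos : 0 < M := lt_of_lt_of_le one_pos (le_max_left _ _)
  have hsc : ∀ z : ∀ k, H (prev k), ∀ k, ‖(M⁻¹ • z) k‖ = M⁻¹ * ‖z k‖ := by
    intro z k
    rw [Pi.smul_apply, norm_smul, Real.norm_of_nonneg (inv_pos.2 hMpos).le]
  have h := normalized (M⁻¹ • x) ?_ ?_
  · rw [partialSum_smul, norm_smul, Real.norm_of_nonneg (inv_pos.2 hMpos).le, hsc] at h
    have h' := mul_le_mul_of_nonneg_left h hMpos.le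
    calc _ = M * (2 * (M⁻¹ * ‖partialSum W (Fin.last n) x‖)) := by field_simp
      _ ≤ _ := h'
      _ = _ := by field_simp
  · rw [hsc, inv_mul_le_iff₀ hMpos, mul_one]
    exact le_max_right _ _
  · intro k hk
    rw [partialSum_smul, norm_smul, Real.norm_of_nonneg (inv_pos.2 hMpos).le, hsc]
    exact mul_le_mul_of_nonneg_left (hx k hk) (inv_pos.2 hMpos).le

end PartialSum

/-! ### The network as one inclusion, and its orbits. -/

namespace Network

variable {n : ℕ} {H : Fin (n + 1) → Type*} [∀ i, NormedAddCommGroup (H i)]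
  [∀ i, InnerProductSpace ℝ (H i)] (N : Network n H)

theorem exists_φ_zero (i : Fin (n + 1)) : ∃ r : ℝ, N.φ i 0 = r := by
  obtain ⟨x, r, hr⟩ := (N.gamma0 i).exists_point
  exact (N.gamma0 i).exists_eq_coe_of_le (hr ▸ N.min_zero i x)

theorem zero_mem_subdifferential_φ (i : Fin (n + 1)) : 0 ∈ subdifferential (N.φ i) 0 := by
  intro y
  rw [inner_zero_right, EReal.coe_zero, zero_add]
  exact N.min_zero i y

theorem isGamma0_bigφ : IsGamma0 N.bigφ := isGamma0_separableSum N.gamma0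

theorem zero_mem_subdifferential_bigφ : 0 ∈ subdifferential N.bigφ 0 :=
  (mem_subdifferential_separableSum_iff N.gamma0).2 N.zero_mem_subdifferential_φ

theorem exists_bigφ_zero : ∃ l : ℝ, N.bigφ 0 = l ∧ ∀ x, (l : EReal) ≤ N.bigφ x := by
  choose r hr using N.exists_φ_zero
  refine ⟨∑ i, r i, separableSum_eq_coe hr, fun x => ?_⟩
  rw [ereal_coe_sum]
  exact Finset.sum_le_sum fun i _ => hr i ▸ N.min_zero i (x i)

/-- The vector `(b_1, …, b_m)`. -/
def bigb : PiLp 2 H := WithLp.toLp 2 N.b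

/-- The bounded linear operator `Id - W ∘ S`. -/
def idSubWSL : PiLp 2 H →L[ℝ] PiLp 2 H :=
  ContinuousLinearMap.id ℝ (PiLp 2 H) - N.bigW ∘L shift H

theorem idSubWSL_apply (x : PiLp 2 H) : N.idSubWSL x = x - N.bigW (shift H x) := rfl

theorem bigb_sub_apply (x : PiLp 2 H) (i : Fin (n + 1)) :
    (N.bigb - N.idSubWSL x) i = N.W i (x (prev i)) + N.b i - x i := by
  change N.b i - (x i - N.W i (x (prev i))) = _
  abel

theorem inner_idSubWSL_nonneg (h : IsMonotoneOp (single N.idSubWS)) (x : PiLp 2 H) :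
    0 ≤ inner ℝ x (N.idSubWSL x) := by
  have := h x 0 _ rfl _ rfl
  simpa [idSubWS, idSubWSL_apply] using this

theorem mem_single_add_iff {E : Type*} [NormedAddCommGroup E] {g : E → E}
    {A : E → Set E} {x u : E} : u ∈ (single g + A) x ↔ u - g x ∈ A x := by
  rw [Pi.add_apply, single, Set.singleton_add]
  constructor
  · rintro ⟨v, hv, rfl⟩
    simpa using hv
  · intro h
    exact ⟨_, h, add_sub_cancel _ _⟩

theorem mem_subdifferential_bigψ_iff {x u : PiLp 2 H} :
    u ∈ subdifferential N.bigψ x ↔ u + N.bigb ∈ subdifferential N.bigφ x := by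
  rw [show N.bigψ = separableSum fun i x => N.φ i x - ((inner ℝ x (N.b i) : ℝ) : EReal) from rfl,
    show N.bigφ = separableSum N.φ from rfl,
    mem_subdifferential_separableSum_iff fun i => (N.gamma0 i).sub_inner (N.b i),
    mem_subdifferential_separableSum_iff N.gamma0]
  exact forall_congr' fun i => mem_subdifferential_sub_inner_iff (N.gamma0 i)

theorem isGamma0_bigψ : IsGamma0 N.bigψ :=
  isGamma0_separableSum (f := fun i x => N.φ i x - ((inner ℝ x (N.b i) : ℝ) : EReal))
    fun i => (N.gamma0 i).sub_inner (N.b i)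

variable [∀ i, CompleteSpace (H i)]

theorem T_eq_iff {i : Fin (n + 1)} {x : H (prev i)} {p : H i} :
    N.T i x = p ↔ N.W i x + N.b i - p ∈ subdifferential (N.φ i) p := by
  obtain ⟨r, hr⟩ := N.exists_φ_zero i
  exact prox_eq_iff (N.gamma0 i) (exists_sub_mem_subdifferential (N.gamma0 i)
    (fun x => hr ▸ N.min_zero i x) _)

theorem mem_bigF_iff {x : PiLp 2 H} :
    x ∈ N.bigF ↔ N.bigb - N.idSubWSL x ∈ subdifferential N.bigφ x := by
  rw [show N.bigφ = separableSum N.φ from rfl, mem_subdifferential_separableSum_iff N.gamma0]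
  refine forall_congr' fun i => ?_
  rw [eq_comm, T_eq_iff, bigb_sub_apply]

theorem viSolutions_eq_bigF : N.viSolutions = N.bigF := by
  ext x
  refine forall_congr' fun i => ?_
  rw [eq_comm (a := x i), T_eq_iff]
  refine (mem_single_add_iff (g := fun p => p - N.W i (x (prev i)))).trans ?_
  rw [show N.b i - (x i - N.W i (x (prev i))) = N.W i (x (prev i)) + N.b i - x i by abel]

theorem bigF_eq_zer :
    N.bigF = zer (single N.idSubWS + subdifferential N.bigψ) := by
  ext x
  rw [mem_bigF_iff]
  refine Iff.trans ?_ mem_single_add_iff.symm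
  rw [mem_subdifferential_bigψ_iff, zero_sub, neg_add_eq_sub]
  rfl

theorem bigF_eq_fixedPoints :
    N.bigF = Function.fixedPoints (prox N.bigψ ∘ N.bigW ∘ shift H) := by
  obtain ⟨l, -, hl⟩ := N.exists_bigφ_zero
  ext x
  have hex : ∃ q, N.bigW (shift H x) - q ∈ subdifferential N.bigψ q := by
    obtain ⟨q, hq⟩ := exists_sub_mem_subdifferential N.isGamma0_bigφ hl
      (N.bigW (shift H x) + N.bigb)
    refine ⟨q, N.mem_subdifferential_bigψ_iff.2 ?_⟩
    rwa [sub_add_eq_add_sub]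
  rw [mem_bigF_iff]
  refine Iff.trans ?_ (prox_eq_iff N.isGamma0_bigψ hex).symm
  rw [mem_subdifferential_bigψ_iff, idSubWSL_apply, sub_add_eq_add_sub, sub_sub_eq_add_sub,
    add_comm N.bigb]

section Orbit

omit [∀ i, CompleteSpace (H i)]

theorem apply_eq_chainFromZero {x : PiLp 2 H} (hx : x ∈ N.bigF) (i : Fin (n + 1)) :
    x i = chainFromZero N.T i (x (Fin.last n)) := by
  obtain ⟨i, hi⟩ := i
  induction i with
  | zero => rw [chainFromZero_zero]; exact hx ⟨0, hi⟩
  | succ j ih =>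
    rw [chainFromZero_succ, ← ih]
    exact hx ⟨j + 1, hi⟩

theorem orbit_apply {x : H (Fin.last n)} (hx : x ∈ N.F) (i : Fin (n + 1)) :
    N.orbit x i = chainFromZero N.T i x := by
  induction i using Fin.lastCases with
  | last =>
    -- `orbit` stores `x` itself in the last slot, whereas the chain gives `N.Tcomp x`; they agree
    -- because `x` is a fixed point.
    refine Eq.trans ?_ hx.symm
    change Fin.lastCases (motive := H) x _ (Fin.last n) = x
    rw [Fin.lastCases_last]
  | cast j =>
    change Fin.lastCases (motive := H) x _ j.castSucc = _
    rw [Fin.lastCases_castSucc]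

theorem orbit_mem_bigF {x : H (Fin.last n)} (hx : x ∈ N.F) : N.orbit x ∈ N.bigF := by
  rintro ⟨_ | j, hi⟩
  · rw [orbit_apply N hx, chainFromZero_zero]
    change N.T ⟨0, hi⟩ x = N.T ⟨0, hi⟩ (N.orbit x (Fin.last n))
    rw [orbit_apply N hx]
    exact congrArg (N.T ⟨0, hi⟩) hx.symm
  · rw [orbit_apply N hx, chainFromZero_succ]
    change _ = N.T ⟨j + 1, hi⟩ (N.orbit x ⟨j, Nat.lt_of_succ_lt hi⟩)
    rw [orbit_apply N hx]

theorem bigF_eq_image_orbit : N.bigF = N.orbit '' N.F := by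
  ext x
  constructor
  · intro hx
    have hF : x (Fin.last n) ∈ N.F := (N.apply_eq_chainFromZero hx (Fin.last n)).symm
    refine ⟨_, hF, ?_⟩
    ext i
    rw [orbit_apply N hF, ← N.apply_eq_chainFromZero hx]
  · rintro ⟨x, hx, rfl⟩
    exact N.orbit_mem_bigF hx

theorem nonempty_bigF_iff : N.bigF.Nonempty ↔ N.F.Nonempty := by
  rw [bigF_eq_image_orbit, Set.image_nonempty]

end Orbit

/-! ### Nonexpansiveness of the composition under the averagedness condition. -/

theorem norm_two_smul_sub_le (i : Fin (n + 1)) (x y : H (prev i)) :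
    ‖(2 : ℝ) • (N.T i x - N.T i y) - N.W i (x - y)‖ ≤ ‖N.W i (x - y)‖ := by
  have h := norm_reflection_le (N.gamma0 i) (N.T_eq_iff.1 (rfl : N.T i x = _))
    (N.T_eq_iff.1 (rfl : N.T i y = _))
  rwa [show N.W i x + N.b i - (N.W i y + N.b i) = N.W i (x - y) by rw [map_sub]; abel] at h

theorem norm_T_sub_le (i : Fin (n + 1)) (x y : H (prev i)) :
    ‖N.T i x - N.T i y‖ ≤ ‖N.W i (x - y)‖ := by
  have h1 := norm_add_le ((2 : ℝ) • (N.T i x - N.T i y) - N.W i (x - y)) (N.W i (x - y))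
  rw [sub_add_cancel, norm_smul, Real.norm_two] at h1
  linarith [N.norm_two_smul_sub_le i x y]

/-- The input of the `k`th layer when the network is fed with `x`. -/
def layerInput (x : H (Fin.last n)) : ∀ k : Fin (n + 1), H (prev k)
  | ⟨0, _⟩ => x
  | ⟨j + 1, h⟩ => chainFromZero N.T ⟨j, Nat.lt_of_succ_lt h⟩ x

omit [∀ i, CompleteSpace (H i)] in
theorem T_layerInput (x : H (Fin.last n)) (k : Fin (n + 1)) :
    N.T k (N.layerInput x k) = chainFromZero N.T k x := by
  obtain ⟨_ | j, h⟩ := k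
  · exact (chainFromZero_zero N.T h x).symm
  · exact (chainFromZero_succ N.T h x).symm

/-- The defect `2 (T_k u - T_k v) - W_k (u - v)` along the trajectories of `x` and `y`. -/
def layerDefect (x y : H (Fin.last n)) (k : Fin (n + 1)) : H k :=
  (2 : ℝ) • (chainFromZero N.T k x - chainFromZero N.T k y)
    - N.W k (N.layerInput x k - N.layerInput y k)

theorem norm_layerDefect_le (x y : H (Fin.last n)) (k : Fin (n + 1)) :
    ‖N.layerDefect x y k‖ ≤ ‖N.W k (N.layerInput x k - N.layerInput y k)‖ := by
  rw [layerDefect, ← T_layerInput, ← T_layerInput]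
  exact N.norm_two_smul_sub_le k _ _

/-- The tuple `(x - y, d_0, 2 d_1, 4 d_2, …)` built from the layer defects. -/
def defectTuple (x y : H (Fin.last n)) : ∀ k : Fin (n + 1), H (prev k)
  | ⟨0, _⟩ => x - y
  | ⟨j + 1, h⟩ => (2 ^ j : ℝ) • N.layerDefect x y ⟨j, Nat.lt_of_succ_lt h⟩

omit [∀ i, CompleteSpace (H i)] in
-- The scaling is chosen for this induction: adding 2^j times the defect of layer j to 2^j W_j(u_j -
-- v_j) leaves 2^(j+1)(T_j u_j - T_j v_j), which is 2^(j+1) times the difference of the next inputs.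
theorem partialSum_defectTuple (x y : H (Fin.last n)) (j : ℕ) (hj : j < n + 1) :
    partialSum N.W ⟨j, hj⟩ (N.defectTuple x y)
      = (2 ^ j : ℝ) • N.W ⟨j, hj⟩ (N.layerInput x ⟨j, hj⟩ - N.layerInput y ⟨j, hj⟩) := by
  induction j with
  | zero =>
    rw [partialSum_zero, pow_zero, one_smul]
    rfl
  | succ j ih =>
    have h1 : sourceSucc (N.defectTuple x y) hj
        = (2 ^ j : ℝ) • N.layerDefect x y ⟨j, Nat.lt_of_succ_lt hj⟩ := rfl
    have h2 : N.W ⟨j + 1, hj⟩ (N.layerInput x ⟨j + 1, hj⟩ - N.layerInput y ⟨j + 1, hj⟩)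
        = succLayer N.W hj (chainFromZero N.T ⟨j, Nat.lt_of_succ_lt hj⟩ x
          - chainFromZero N.T ⟨j, Nat.lt_of_succ_lt hj⟩ y) := rfl
    rw [partialSum_succ, ih, h1, h2, layerDefect, ← map_smul (succLayer N.W hj)]
    refine congrArg (succLayer N.W hj) ?_
    module

theorem norm_Tcomp_sub_le {α : ℝ} (hα : α ≤ 1) (hW : AveragednessCondition N.W α)
    (x y : H (Fin.last n)) : ‖N.Tcomp x - N.Tcomp y‖ ≤ ‖x - y‖ := by
  have h := hW.norm_partialSum_le hα (N.defectTuple x y) fun k hk => ?_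
  · have h1 := N.partialSum_defectTuple x y n (Nat.lt_succ_self n)
    have h2 : ‖partialSum N.W (Fin.last n) (N.defectTuple x y)‖
        = 2 ^ n * ‖N.W (Fin.last n)
          (N.layerInput x (Fin.last n) - N.layerInput y (Fin.last n))‖ := by
      refine (congrArg norm h1).trans ?_
      rw [norm_smul, Real.norm_of_nonneg (by positivity)]
      rfl
    have h3 := N.norm_T_sub_le _ (N.layerInput x (Fin.last n)) (N.layerInput y (Fin.last n))
    rw [T_layerInput, T_layerInput] at h3
    rw [h2, pow_succ] at h
    refine h3.trans ?_
    have h4 : ‖N.defectTuple x y ⟨0, Nat.succ_pos n⟩‖ = ‖x - y‖ := rfl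
    rw [h4] at h
    have h5 : (0 : ℝ) < 2 ^ n := by positivity
    refine le_of_mul_le_mul_left ?_ (mul_pos h5 two_pos)
    linarith
  · rw [partialSum_defectTuple, norm_smul, Real.norm_of_nonneg (by positivity)]
    change ‖(2 ^ k : ℝ) • N.layerDefect x y ⟨k, Nat.lt_of_succ_lt hk⟩‖ ≤ _
    rw [norm_smul, Real.norm_of_nonneg (by positivity)]
    exact mul_le_mul_of_nonneg_left (N.norm_layerDefect_le x y _) (by positivity)

theorem T_mem_dom (i : Fin (n + 1)) (x : H (prev i)) : N.T i x ∈ dom (N.φ i) := by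
  obtain ⟨r, hr, -⟩ := (mem_subdifferential_iff (N.gamma0 i)).1
    (N.T_eq_iff.1 (rfl : N.T i x = _))
  change N.φ i (N.T i x) < ⊤
  rw [hr]
  exact EReal.coe_lt_top r

/-- The output of layer `j` lies in dom φ_j, and every later layer is Lipschitz, so boundedness
propagates to the last one. -/
theorem isBounded_range_Tcomp {j : Fin (n + 1)} (hj : Bornology.IsBounded (dom (N.φ j))) :
    Bornology.IsBounded (Set.range N.Tcomp) := by
  have key : ∀ k (hk : k < n + 1), j.1 ≤ k → ∃ R, ∀ x, ‖chainFromZero N.T ⟨k, hk⟩ x‖ ≤ R := by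
    intro k hk hjk
    induction k, hjk using Nat.le_induction with
    | base =>
      obtain ⟨R, hR⟩ := hj.exists_norm_le
      refine ⟨R, fun x => ?_⟩
      rw [← T_layerInput]
      exact hR _ (N.T_mem_dom j _)
    | succ k hjk ih =>
      obtain ⟨R, hR⟩ := ih (Nat.lt_of_succ_lt hk)
      refine ⟨‖N.W ⟨k + 1, hk⟩‖ * R + ‖N.T ⟨k + 1, hk⟩ 0‖, fun x => ?_⟩
      rw [← T_layerInput]
      have h1 := N.norm_T_sub_le ⟨k + 1, hk⟩ (N.layerInput x ⟨k + 1, hk⟩) 0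
      rw [sub_zero] at h1
      have h2 := (N.W ⟨k + 1, hk⟩).le_opNorm (N.layerInput x ⟨k + 1, hk⟩)
      have h3 : ‖N.layerInput x ⟨k + 1, hk⟩‖ ≤ R := hR x
      have h4 := mul_le_mul_of_nonneg_left h3 (norm_nonneg (N.W ⟨k + 1, hk⟩))
      have h5 := norm_sub_norm_le (N.T ⟨k + 1, hk⟩ (N.layerInput x ⟨k + 1, hk⟩))
        (N.T ⟨k + 1, hk⟩ 0)
      linarith
  obtain ⟨R, hR⟩ := key n (Nat.lt_succ_self n) (Nat.le_of_lt_succ j.2)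
  refine isBounded_iff_forall_norm_le.2 ⟨R, ?_⟩
  rintro _ ⟨x, rfl⟩
  exact hR x

end Network

/-! ### A priori bounds for the regularized inclusions. -/

section Existence

variable {E : Type*} [NormedAddCommGroup E] [InnerProductSpace ℝ E] {f : E → EReal}
  {C : E →L[ℝ] E}

theorem exists_norm_le_inner_eq {r : ℝ} (hr : 0 ≤ r) (v : E) :
    ∃ h : E, ‖h‖ ≤ r ∧ inner ℝ h v = r * ‖v‖ := by
  rcases eq_or_ne v 0 with rfl | hv
  · exact ⟨0, by simpa using hr, by simp⟩
  · have hv' : ‖v‖ ≠ 0 := norm_ne_zero_iff.2 hv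
    refine ⟨(r / ‖v‖) • v, ?_, ?_⟩
    · rw [norm_smul, Real.norm_of_nonneg (by positivity), div_mul_cancel₀ _ hv']
    · rw [real_inner_smul_left, real_inner_self_eq_norm_sq]
      field_simp

/-- If the conjugate is finite everywhere, then the function is supercoercive in every direction
up to any prescribed linear form. -/
theorem exists_coercive_of_dom_conjugate [CompleteSpace E] (hf : dom (conjugate f) = Set.univ)
    (u : E) : ∃ r : ℝ, 0 < r ∧ ∃ M : ℝ, ∀ (x : E) (s : ℝ), f x = s →
      inner ℝ x u + r * ‖x‖ ≤ s + M := by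
  let K : ℕ → Set E := fun n => {w | ∀ (x : E) (s : ℝ), f x = s → inner ℝ x w - s ≤ n}
  have hclosed : ∀ n, IsClosed (K n) := by
    intro n
    simp only [K, Set.ofPred_forall]
    refine isClosed_iInter fun x => isClosed_iInter fun s => isClosed_iInter fun _ => ?_
    exact isClosed_le ((continuous_const.inner continuous_id).sub continuous_const)
      continuous_const
  have hcover : ∀ w, ∃ n, w ∈ K n := by
    intro w
    have hw : conjugate f w < ⊤ := by
      have : w ∈ dom (conjugate f) := hf ▸ Set.mem_univ w
      exact this
    obtain ⟨c, hc, -⟩ := EReal.lt_iff_exists_real_btwn.1 hw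
    obtain ⟨n, hn⟩ := exists_nat_ge c
    refine ⟨n, fun x s hs => ?_⟩
    have h1 : ((inner ℝ x w : ℝ) : EReal) - f x ≤ c :=
      (le_iSup (fun x => ((inner ℝ x w : ℝ) : EReal) - f x) x).trans hc.le
    rw [hs, ← EReal.coe_sub, EReal.coe_le_coe_iff] at h1
    linarith
  -- By Baire, the conjugate is bounded above on a ball around some `a`. Averaging with its bound at
  -- 2u - a moves the estimate to u; taking `h` along `x` with norm at most ρ/2 produces (ρ/4)‖x‖.
  obtain ⟨n, a, ha⟩ := nonempty_interior_of_iUnion_of_closed hclosed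
    (Set.eq_univ_of_forall fun w => Set.mem_iUnion.2 (hcover w))
  obtain ⟨ρ, hρ, hball⟩ := Metric.isOpen_iff.1 isOpen_interior a ha
  obtain ⟨m, hm⟩ := hcover ((2 : ℝ) • u - a)
  refine ⟨ρ / 4, by positivity, ((n : ℝ) + m) / 2, fun x s hs => ?_⟩
  obtain ⟨h, hh, hx⟩ := exists_norm_le_inner_eq (half_pos hρ).le x
  have h1 : a + h ∈ K n := interior_subset (hball (by
    rw [Metric.mem_ball, dist_eq_norm, add_sub_cancel_left]
    linarith))
  have h2 := h1 x s hs
  have h3 := hm x s hs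
  rw [inner_add_right, real_inner_comm, real_inner_comm h x] at h2
  rw [inner_sub_right, real_inner_smul_right, real_inner_comm a x] at h3
  linarith

/-- A function in `Γ₀` that is finite everywhere is locally bounded above. -/
theorem exists_le_of_dom_eq_univ [CompleteSpace E] (hf : IsGamma0 f) (hdom : dom f = Set.univ)
    (a : E) : ∃ r : ℝ, 0 < r ∧ ∃ M : ℝ, ∀ h : E, ‖h‖ ≤ r → f (a + h) ≤ M := by
  have hfin : ∀ x, ∃ n : ℕ, f x ≤ ((n : ℝ) : EReal) := by
    intro x
    have hx : x ∈ dom f := hdom ▸ Set.mem_univ x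
    obtain ⟨s, hs⟩ := hf.exists_eq_coe (ne_of_lt hx)
    obtain ⟨n, hn⟩ := exists_nat_ge s
    exact ⟨n, by rw [hs, EReal.coe_le_coe_iff]; exact hn⟩
  -- Baire bounds `f` above on a ball around some `c`; convexity moves the bound to `a`, as a + h is
  -- the midpoint of c + 2h and 2a - c.
  obtain ⟨n, c, hc⟩ := nonempty_interior_of_iUnion_of_closed
    (f := fun n : ℕ => f ⁻¹' Set.Iic ((n : ℝ) : EReal))
    (fun n => hf.lsc.isClosed_preimage _)
    (Set.eq_univ_of_forall fun x => Set.mem_iUnion.2 (hfin x))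
  obtain ⟨ρ, hρ, hball⟩ := Metric.isOpen_iff.1 isOpen_interior c hc
  obtain ⟨m, hm⟩ := hfin ((2 : ℝ) • a - c)
  refine ⟨ρ / 4, by positivity, 1 / 2 * (n : ℝ) + 1 / 2 * m, fun h hh => ?_⟩
  have h0 : c + (2 : ℝ) • h ∈ Metric.ball c ρ := by
    rw [Metric.mem_ball, dist_eq_norm, add_sub_cancel_left, norm_smul, Real.norm_two]
    linarith
  have h0 := interior_subset (hball h0)
  have h1 : f (c + (2 : ℝ) • h) ≤ ((n : ℝ) : EReal) := h0
  have h2 := hf.combo_le h1 hm (by norm_num : (0 : ℝ) ≤ 1 / 2) (by norm_num : (0 : ℝ) ≤ 1 / 2)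
    (by norm_num)
  have h3 : (1 / 2 : ℝ) • (c + (2 : ℝ) • h) + (1 / 2 : ℝ) • ((2 : ℝ) • a - c) = a + h := by
    module
  rwa [h3] at h2

/-- A surjective monotone bounded linear operator is bounded below. -/
theorem exists_norm_le_of_surjective_of_monotone [CompleteSpace E]
    (hC : ∀ x, 0 ≤ inner ℝ x (C x)) (hsurj : Function.Surjective C) :
    ∃ K : ℝ, 0 < K ∧ ∀ x, ‖x‖ ≤ K * ‖C x‖ := by
  have hker : ∀ x, C x = 0 → x = 0 := by
    intro x hx
    obtain ⟨y, hy⟩ := hsurj (-x)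
    -- With C x = 0 and C y = -x, monotonicity at x + t y reads ‖x‖² ≤ t⟪y, C y⟫ for every small t >
    -- 0.
    have : ‖x‖ ^ 2 ≤ 0 := by
      refine nonpos_of_forall_le_mul (b := inner ℝ y (C y)) fun t ht _ => ?_
      have h := hC (x + t • y)
      rw [map_add, map_smul, hx, zero_add, inner_add_left, real_inner_smul_left,
        real_inner_smul_right, real_inner_smul_right] at h
      have h1 : inner ℝ x (C y) = -‖x‖ ^ 2 := by
        rw [hy, inner_neg_right, real_inner_self_eq_norm_sq]
      rw [h1, ← mul_add] at h
      have := nonneg_of_mul_nonneg_right h ht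
      linarith
    exact norm_eq_zero.1 (pow_eq_zero_iff two_ne_zero |>.1 (le_antisymm this (sq_nonneg _)))
  obtain ⟨K, hK, h⟩ := C.exists_preimage_norm_le hsurj
  refine ⟨K, hK, fun x => ?_⟩
  obtain ⟨y, hy, hle⟩ := h (C x)
  have : y - x = 0 := hker _ (by rw [map_sub, hy, sub_self])
  rwa [sub_eq_zero.1 this] at hle

theorem inner_nonneg_of_mem_subdifferential (hf : IsGamma0 f) (h0 : 0 ∈ subdifferential f 0)
    {x v : E} (hv : v ∈ subdifferential f x) : 0 ≤ inner ℝ x v := by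
  simpa using subdifferential_monotone hf x 0 v hv 0 h0

/-- Solvability when the linear operator is surjective and cocoercive. -/
theorem exists_mem_subdifferential_of_cocoercive [CompleteSpace E] (hf : IsGamma0 f)
    {l : ℝ} (hl : ∀ x, (l : EReal) ≤ f x) (h0 : 0 ∈ subdifferential f 0)
    (hC : ∀ x, ‖C x‖ ^ 2 ≤ 2 * inner ℝ x (C x)) (hsurj : Function.Surjective C) (u : E) :
    ∃ x, u - C x ∈ subdifferential f x := by
  have hmon : ∀ x, 0 ≤ inner ℝ x (C x) := fun x => by linarith [hC x, sq_nonneg ‖C x‖]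
  obtain ⟨K, hK, hle⟩ := exists_norm_le_of_surjective_of_monotone hmon hsurj
  -- The bound comes from ‖x‖² ≤ K²‖C x‖² ≤ 2K²⟪x, C x⟫ ≤ 2K²⟪x, u⟫.
  refine exists_mem_subdifferential_of_bounded hf hl hmon (R := 2 * K ^ 2 * ‖u‖)
    fun e x he _ hx => ?_
  have h1 := inner_nonneg_of_mem_subdifferential hf h0 hx
  rw [inner_sub_right, inner_add_right, real_inner_smul_right, real_inner_self_eq_norm_sq] at h1
  have h2 := real_inner_le_norm x u
  have h3 : 0 ≤ e * ‖x‖ ^ 2 := by positivity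
  have h4 := hC x
  have h5 : ‖x‖ ^ 2 ≤ K ^ 2 * ‖C x‖ ^ 2 := by
    rw [← mul_pow]
    exact pow_le_pow_left₀ (norm_nonneg _) (hle x) 2
  have h6 : K ^ 2 * ‖C x‖ ^ 2 ≤ K ^ 2 * (2 * (‖x‖ * ‖u‖)) :=
    mul_le_mul_of_nonneg_left (by linarith) (sq_nonneg K)
  rcases (norm_nonneg x).eq_or_lt with h7 | h7
  · rw [← h7]; positivity
  · refine le_of_mul_le_mul_left ?_ h7
    linarith

/-- Solvability when the function grows at least linearly after subtraction of the linear form. -/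
theorem exists_mem_subdifferential_of_coercive [CompleteSpace E] (hf : IsGamma0 f)
    {l : ℝ} (hl : ∀ x, (l : EReal) ≤ f x) (h0 : f 0 = l) (hC : ∀ x, 0 ≤ inner ℝ x (C x))
    {u : E} {r M : ℝ} (hr : 0 < r)
    (hM : ∀ (x : E) (s : ℝ), f x = s → inner ℝ x u + r * ‖x‖ ≤ s + M) :
    ∃ x, u - C x ∈ subdifferential f x := by
  -- The subgradient inequality tested at 0 gives s ≤ l + ⟪x, u⟫; comparison with `hM` leaves r‖x‖ ≤
  -- l + M.
  refine exists_mem_subdifferential_of_bounded hf hl hC (R := (l + M) / r) fun e x he _ hx => ?_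
  obtain ⟨s, hs, h⟩ := (mem_subdifferential_iff hf).1 hx
  have h1 := h 0 l h0
  rw [zero_sub, inner_neg_left, inner_sub_right, inner_add_right, real_inner_smul_right,
    real_inner_self_eq_norm_sq] at h1
  have h2 : 0 ≤ e * ‖x‖ ^ 2 := by positivity
  have h3 := hM x s hs
  have h4 := hC x
  rw [le_div_iff₀ hr]
  linarith

/-- Solvability when the linear operator is surjective and the function is finite everywhere. -/
theorem exists_mem_subdifferential_of_dom_eq_univ [CompleteSpace E] (hf : IsGamma0 f)
    {l : ℝ} (hl : ∀ x, (l : EReal) ≤ f x) (hdom : dom f = Set.univ)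
    (hC : ∀ x, 0 ≤ inner ℝ x (C x)) (hsurj : Function.Surjective C) (u : E) :
    ∃ x, u - C x ∈ subdifferential f x := by
  obtain ⟨K, hK, hle⟩ := exists_norm_le_of_surjective_of_monotone hC hsurj
  obtain ⟨a, rfl⟩ := hsurj u
  obtain ⟨r, hr, M, hM⟩ := exists_le_of_dom_eq_univ hf hdom a
  have hlM : l ≤ M := by
    have := (hl a).trans (by simpa using hM 0 (by simpa using hr.le))
    exact EReal.coe_le_coe_iff.1 this
  -- `B` bounds t = e‖x‖: the estimates below give t² ≤ (M - l) + t‖a‖, which fails when t > B ≥ 1.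
  set B := 1 + (M - l) + ‖a‖ with hB
  refine exists_mem_subdifferential_of_bounded hf hl hC
    (R := ‖a‖ + K * (B + (M - l + B * ‖a‖) / r)) fun e x he he1 hx => ?_
  obtain ⟨s, hs, h⟩ := (mem_subdifferential_iff hf).1 hx
  have hls : l ≤ s := EReal.coe_le_coe_iff.1 (hs ▸ hl x)
  set v := C a - (e • x + C x) with hv
  have hsub : ∀ d : E, ‖d‖ ≤ r → inner ℝ (a + d - x) v + s ≤ M := by
    intro d hd
    obtain ⟨t, ht⟩ := hf.exists_eq_coe_of_le (hM d hd)
    have h1 := hM d hd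
    rw [ht, EReal.coe_le_coe_iff] at h1
    exact (h _ _ ht).trans h1
  have hinner : e * ‖x‖ ^ 2 - e * ‖x‖ * ‖a‖ ≤ inner ℝ (a - x) v := by
    have h1 := hC (a - x)
    have h2 : v = C (a - x) - e • x := by rw [hv, map_sub]; abel
    have h3 := mul_le_mul_of_nonneg_left (real_inner_le_norm a x) he.le
    rw [h2, inner_sub_right, real_inner_smul_right, inner_sub_left, inner_sub_left a x x,
      real_inner_self_eq_norm_sq, ← inner_sub_left]
    linarith
  have hex : e * ‖x‖ ≤ B := by
    have h1 := hsub 0 (by simpa using hr.le)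
    rw [add_zero] at h1
    by_contra! h2
    have h3 : 0 ≤ ‖a‖ := norm_nonneg a
    have h4 : 0 ≤ e * ‖x‖ := by positivity
    have h5 : e * (e * ‖x‖ ^ 2) ≤ 1 * (M - l) + e * ‖x‖ * ‖a‖ := by
      have h6 : e * ‖x‖ ^ 2 ≤ (M - l) + e * ‖x‖ * ‖a‖ := by linarith
      have h7 : 0 ≤ (M - l) + e * ‖x‖ * ‖a‖ := by
        have := mul_nonneg h4 h3
        linarith
      calc _ ≤ e * ((M - l) + e * ‖x‖ * ‖a‖) := mul_le_mul_of_nonneg_left h6 he.le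
        _ ≤ 1 * ((M - l) + e * ‖x‖ * ‖a‖) := mul_le_mul_of_nonneg_right he1 h7
        _ = _ := by ring
    have h8 : e * ‖x‖ * B < e * ‖x‖ * (e * ‖x‖) :=
      mul_lt_mul_of_pos_left h2 (by linarith)
    have h9 : 1 * (M - l) ≤ e * ‖x‖ * (M - l) :=
      mul_le_mul_of_nonneg_right (by linarith) (by linarith)
    rw [hB] at h8
    linarith
  -- Testing at a + d with `d` along `v` makes r‖v‖ appear. Once e x and v are bounded, so is C(x -
  -- a) = -(e x + v), and `hle` bounds x.
  have hvle : ‖v‖ ≤ (M - l + B * ‖a‖) / r := by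
    obtain ⟨d, hd, hdv⟩ := exists_norm_le_inner_eq hr.le v
    have h1 := hsub d hd
    rw [add_sub_right_comm, inner_add_left, hdv] at h1
    have h2 := mul_le_mul_of_nonneg_right hex (norm_nonneg a)
    have h3 : 0 ≤ e * ‖x‖ ^ 2 := by positivity
    rw [le_div_iff₀ hr]
    linarith
  have h1 := hle (x - a)
  have h2 : C (x - a) = -(e • x + v) := by rw [hv, map_sub]; abel
  rw [h2, norm_neg] at h1
  have h3 := norm_add_le (e • x) v
  rw [norm_smul, Real.norm_of_nonneg he.le] at h3
  have h4 : ‖e • x + v‖ ≤ B + (M - l + B * ‖a‖) / r := by linarith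
  have h5 := mul_le_mul_of_nonneg_left h4 hK.le
  have h6 := norm_sub_norm_le x a
  linarith

end Existence

/-! ### The cyclic shift is unitary; closed range and surjectivity. -/

section Shift

variable {n : ℕ} {H : Fin (n + 1) → Type*} [∀ i, NormedAddCommGroup (H i)]
  [∀ i, InnerProductSpace ℝ (H i)]

theorem inner_shift_shift (x y : PiLp 2 H) :
    inner ℝ (shift H x) (shift H y) = inner ℝ x y := by
  rw [PiLp.inner_apply, PiLp.inner_apply]
  exact (Equiv.ofBijective _ prev_bijective).sum_comp fun i => inner ℝ (x i) (y i)

theorem shift_surjective : Function.Surjective (shift H) := by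
  intro z
  refine ⟨WithLp.toLp 2 (Equiv.piCongrLeft H (Equiv.ofBijective _ prev_bijective) z.ofLp), ?_⟩
  ext i
  exact Equiv.piCongrLeft_apply_apply H (Equiv.ofBijective _ prev_bijective) z.ofLp i

variable [∀ i, CompleteSpace (H i)]

theorem adjoint_shift_apply_shift (x : PiLp 2 H) :
    ContinuousLinearMap.adjoint (shift H) (shift H x) = x := by
  refine ext_inner_right ℝ fun y => ?_
  rw [ContinuousLinearMap.adjoint_inner_left, inner_shift_shift]

end Shift

/-- The kernel of the adjoint is the orthogonal complement of the range, so the range is dense;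
being closed, it is everything. -/
theorem surjective_of_isClosed_range_of_ker_adjoint {E F : Type*} [NormedAddCommGroup E]
    [InnerProductSpace ℝ E] [NormedAddCommGroup F] [InnerProductSpace ℝ F] [CompleteSpace E]
    [CompleteSpace F] {A : E →L[ℝ] F} (hA : IsClosed (Set.range A))
    (hker : (ContinuousLinearMap.adjoint A).ker = ⊥) : Function.Surjective A := by
  have h1 := ContinuousLinearMap.orthogonal_range A
  rw [hker] at h1
  have h2 := Submodule.topologicalClosure_eq_top_iff.2 h1
  have h3 : IsClosed (A.range : Set F) := hA
  rw [h3.submodule_topologicalClosure_eq] at h2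
  exact LinearMap.range_eq_top.1 h2

/-! ### Nonemptiness, closedness and convexity of `bigF`. -/

namespace Network

variable {n : ℕ} {H : Fin (n + 1) → Type*} [∀ i, NormedAddCommGroup (H i)]
  [∀ i, InnerProductSpace ℝ (H i)] (N : Network n H)

/-- Expand ‖x - C x‖² ≤ ‖x‖², which holds because W∘S = Id - C is nonexpansive. -/
theorem norm_sq_idSubWSL_le (hW : ∀ i, ‖N.W i‖ ≤ 1) (x : PiLp 2 H) :
    ‖N.idSubWSL x‖ ^ 2 ≤ 2 * inner ℝ x (N.idSubWSL x) := by
  have h1 : ‖N.bigW (shift H x)‖ ^ 2 ≤ ‖x‖ ^ 2 := by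
    have h2 : ‖x‖ ^ 2 = ∑ i, ‖shift H x i‖ ^ 2 := by
      rw [← PiLp.norm_sq_eq_of_L2, ← real_inner_self_eq_norm_sq, ← real_inner_self_eq_norm_sq,
        inner_shift_shift]
    rw [h2, PiLp.norm_sq_eq_of_L2]
    refine Finset.sum_le_sum fun i _ => pow_le_pow_left₀ (norm_nonneg _) ?_ 2
    rw [bigW_apply]
    exact ((N.W i).le_opNorm _).trans (mul_le_of_le_one_left (norm_nonneg _) (hW i))
  have h3 : N.bigW (shift H x) = x - N.idSubWSL x := by rw [idSubWSL_apply, sub_sub_cancel]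
  rw [h3, norm_sub_sq_real] at h1
  linarith

variable [∀ i, CompleteSpace (H i)]

/-- As S*S = Id, the operator C equals (S* - W)∘S, a composition of surjections. -/
theorem idSubWSL_surjective
    (hcl : IsClosed (Set.range (ContinuousLinearMap.adjoint (shift H) - N.bigW)))
    (hker : (shift H - ContinuousLinearMap.adjoint N.bigW).ker = ⊥) :
    Function.Surjective N.idSubWSL := by
  have h1 : Function.Surjective (ContinuousLinearMap.adjoint (shift H) - N.bigW) := by
    refine surjective_of_isClosed_range_of_ker_adjoint hcl ?_
    rwa [map_sub, ContinuousLinearMap.adjoint_adjoint]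
  intro z
  obtain ⟨y, rfl⟩ := h1 z
  obtain ⟨x, rfl⟩ := shift_surjective y
  refine ⟨x, ?_⟩
  rw [sub_apply, adjoint_shift_apply_shift, idSubWSL_apply]

theorem nonempty_bigF_of_exists
    (h : ∃ x, N.bigb - N.idSubWSL x ∈ subdifferential N.bigφ x) : N.bigF.Nonempty :=
  h.imp fun _ => N.mem_bigF_iff.2

theorem nonempty_bigF_of_surjective
    (h : IsSurjectiveOp (single N.idSubWS + subdifferential N.bigφ)) : N.bigF.Nonempty := by
  obtain ⟨x, hx⟩ := h N.bigb
  exact N.nonempty_bigF_of_exists ⟨x, mem_single_add_iff.1 hx⟩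

/-- Adding -W S x to the regularized subgradient b - e x - C x leaves b - (1+e)x. Monotonicity
against the pair (0, 0) gives (1+e)‖x‖² ≤ ⟪x, b⟫, hence ‖x‖ ≤ ‖b‖. -/
theorem nonempty_bigF_of_monotone (hC : ∀ x, 0 ≤ inner ℝ x (N.idSubWSL x))
    (h : IsMonotoneOp (subdifferential N.bigφ + single (fun x => -N.bigW (shift H x)))) :
    N.bigF.Nonempty := by
  obtain ⟨l, -, hl⟩ := N.exists_bigφ_zero
  refine N.nonempty_bigF_of_exists (exists_mem_subdifferential_of_bounded N.isGamma0_bigφ hl hC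
    (R := ‖N.bigb‖) fun e x he _ hx => ?_)
  have h1 := h x 0 _ (Set.add_mem_add hx rfl) _
    (Set.add_mem_add N.zero_mem_subdifferential_bigφ rfl)
  have h2 : N.bigb - (e • x + N.idSubWSL x) + -N.bigW (shift H x)
      - (0 + -N.bigW (shift H 0)) = N.bigb - (1 + e) • x := by
    rw [idSubWSL_apply, map_zero, map_zero]
    module
  rw [h2, sub_zero, inner_sub_right, real_inner_smul_right, real_inner_self_eq_norm_sq] at h1
  have h3 := real_inner_le_norm x N.bigb
  have h4 : 0 ≤ e * ‖x‖ ^ 2 := by positivity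
  rcases (norm_nonneg x).eq_or_lt with h5 | h5
  · rw [← h5]; positivity
  · refine le_of_mul_le_mul_left ?_ h5
    linarith

theorem nonempty_bigF_of_norm_le_one (hW : ∀ i, ‖N.W i‖ ≤ 1)
    (hsurj : Function.Surjective N.idSubWSL) : N.bigF.Nonempty := by
  obtain ⟨l, -, hl⟩ := N.exists_bigφ_zero
  exact N.nonempty_bigF_of_exists (exists_mem_subdifferential_of_cocoercive N.isGamma0_bigφ hl
    N.zero_mem_subdifferential_bigφ (N.norm_sq_idSubWSL_le hW) hsurj _)

theorem nonempty_bigF_of_dom_conjugate (hC : ∀ x, 0 ≤ inner ℝ x (N.idSubWSL x))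
    (hdom : ∀ i, dom (conjugate (N.φ i)) = Set.univ) : N.bigF.Nonempty := by
  obtain ⟨l, h0, hl⟩ := N.exists_bigφ_zero
  choose r hr M hM using fun i => exists_coercive_of_dom_conjugate (hdom i) (N.b i)
  -- The smallest coercivity constant serves for all coordinates, since ‖x‖ ≤ ∑ ‖x_i‖.
  obtain ⟨j, hj⟩ := Finite.exists_min r
  refine N.nonempty_bigF_of_exists (exists_mem_subdifferential_of_coercive N.isGamma0_bigφ hl h0
    hC (hr j) (M := ∑ i, M i) fun x s hs => ?_)
  obtain ⟨p, hp⟩ := exists_eq_coe_of_separableSum N.gamma0 (x := x)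
    (hs.trans_ne (EReal.coe_ne_top s))
  obtain rfl : s = ∑ i, p i :=
    EReal.coe_eq_coe_iff.1 (hs.symm.trans (separableSum_eq_coe hp))
  have h1 : r j * ‖x‖ ≤ ∑ i, r i * ‖x i‖ := by
    refine (mul_le_mul_of_nonneg_left (piLp_norm_le_sum x) (hr j).le).trans ?_
    rw [Finset.mul_sum]
    exact Finset.sum_le_sum fun i _ => mul_le_mul_of_nonneg_right (hj i) (norm_nonneg _)
  have h2 := Finset.sum_le_sum fun i (_ : i ∈ Finset.univ) => hM i (x i) (p i) (hp i)
  rw [Finset.sum_add_distrib, Finset.sum_add_distrib] at h2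
  have h3 : inner ℝ x N.bigb = ∑ i, inner ℝ (x i) (N.b i) := PiLp.inner_apply x N.bigb
  rw [h3]
  linarith

theorem nonempty_bigF_of_dom (hC : ∀ x, 0 ≤ inner ℝ x (N.idSubWSL x))
    (hsurj : Function.Surjective N.idSubWSL) (hdom : ∀ i, dom (N.φ i) = Set.univ) :
    N.bigF.Nonempty := by
  obtain ⟨l, -, hl⟩ := N.exists_bigφ_zero
  refine N.nonempty_bigF_of_exists (exists_mem_subdifferential_of_dom_eq_univ N.isGamma0_bigφ hl
    (Set.eq_univ_of_forall fun x => ?_) hC hsurj _)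
  have h1 : ∀ i, N.φ i (x i) ≠ ⊤ := fun i => by
    have : x i ∈ dom (N.φ i) := hdom i ▸ Set.mem_univ _
    exact ne_of_lt this
  choose p hp using fun i => (N.gamma0 i).exists_eq_coe (h1 i)
  have h2 : N.bigφ x = _ := separableSum_eq_coe hp
  change N.bigφ x < ⊤
  rw [h2]
  exact EReal.coe_lt_top _

theorem nonempty_bigF_of_isBounded_dom (hC : ∀ x, 0 ≤ inner ℝ x (N.idSubWSL x))
    (hb : ∀ i, Bornology.IsBounded (dom (N.φ i))) : N.bigF.Nonempty := by
  obtain ⟨l, -, hl⟩ := N.exists_bigφ_zero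
  choose R hR using fun i => (hb i).exists_norm_le
  refine N.nonempty_bigF_of_exists (exists_mem_subdifferential_of_bounded N.isGamma0_bigφ hl hC
    (R := ∑ i, R i) fun e x _ _ hx => ?_)
  refine (piLp_norm_le_sum x).trans (Finset.sum_le_sum fun i _ => hR i _ ?_)
  obtain ⟨r, hr, -⟩ := (mem_subdifferential_iff (N.gamma0 i)).1
    ((mem_subdifferential_separableSum_iff N.gamma0).1 hx i)
  change N.φ i (x i) < ⊤
  rw [hr]
  exact EReal.coe_lt_top r

theorem isClosed_bigF : IsClosed N.bigF := by
  refine IsSeqClosed.isClosed fun x p hx hp => N.mem_bigF_iff.2 ?_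
  exact mem_subdifferential_of_tendsto N.isGamma0_bigφ hp
    (tendsto_const_nhds.sub ((N.idSubWSL.continuous.tendsto p).comp hp))
    fun k => N.mem_bigF_iff.1 (hx k)

theorem convex_bigF (hC : ∀ x, 0 ≤ inner ℝ x (N.idSubWSL x)) : Convex ℝ N.bigF := by
  have h := convex_setOf_sub_mem_subdifferential N.isGamma0_bigφ hC N.bigb
  rwa [← show N.bigF = {x | N.bigb - N.idSubWSL x ∈ subdifferential N.bigφ x} from
    Set.ext fun x => N.mem_bigF_iff] at h

end Network

end VINet

end

theorem proposition4p2 {n : ℕ} {H : Fin (n + 1) → Type*} [∀ i, NormedAddCommGroup (H i)]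
    [∀ i, InnerProductSpace ℝ (H i)] [∀ i, CompleteSpace (H i)] (N : VINet.Network n H) :
    -- (i)
    N.viSolutions = N.bigF ∧
    -- (ii)
    (N.bigF = VINet.zer (VINet.single N.idSubWS + VINet.subdifferential N.bigψ) ∧
      N.bigF = Function.fixedPoints (VINet.prox N.bigψ ∘ N.bigW ∘ VINet.shift H)) ∧
    -- (iii)
    N.bigF = N.orbit '' N.F ∧
    -- (iv)
    (∀ α ∈ Set.Icc (1 / 2 : ℝ) 1, VINet.AveragednessCondition N.W α →
      IsClosed N.F ∧ Convex ℝ N.F) ∧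
    -- (v)
    (∀ α ∈ Set.Icc (1 / 2 : ℝ) 1, VINet.AveragednessCondition N.W α →
      (Bornology.IsBounded (Set.range N.Tcomp) ∨
        ∃ j, Bornology.IsBounded (VINet.dom (N.φ j))) →
      N.F.Nonempty ∧ N.bigF.Nonempty) ∧
    -- (vi)
    (VINet.IsMonotoneOp (VINet.single N.idSubWS) →
      (IsClosed N.bigF ∧ Convex ℝ N.bigF) ∧
      (( -- (a)
        VINet.IsSurjectiveOp (VINet.single N.idSubWS + VINet.subdifferential N.bigφ) ∨
        -- (b)
        VINet.IsMaximallyMonotoneOp (VINet.subdifferential N.bigφ +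
          VINet.single (fun x => -N.bigW (VINet.shift H x))) ∨
        -- (c)
        ((∀ i, ‖N.W i‖ ≤ 1) ∧
          IsClosed (Set.range (ContinuousLinearMap.adjoint (VINet.shift H) - N.bigW)) ∧
          (VINet.shift H - ContinuousLinearMap.adjoint N.bigW).ker = ⊥) ∨
        -- (d)
        ((∀ i, ‖N.W i‖ ≤ 1) ∧ ∀ i, VINet.dom (VINet.conjugate (N.φ i)) = Set.univ) ∨
        -- (e)
        (∀ i, VINet.dom (N.φ i) = Set.univ ∧
          VINet.dom (VINet.conjugate (N.φ i)) = Set.univ) ∨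
        -- (f)
        (IsClosed (Set.range (ContinuousLinearMap.adjoint (VINet.shift H) - N.bigW)) ∧
          (VINet.shift H - ContinuousLinearMap.adjoint N.bigW).ker = ⊥ ∧
          ∀ i, VINet.dom (N.φ i) = Set.univ) ∨
        -- (g)
        (∀ i, Bornology.IsBounded (VINet.dom (N.φ i)))) →
        N.F.Nonempty ∧ N.bigF.Nonempty)) := by
  refine ⟨N.viSolutions_eq_bigF, ⟨N.bigF_eq_zer, N.bigF_eq_fixedPoints⟩, N.bigF_eq_image_orbit,
    fun α hα hW => ?_, fun α hα hW hb => ?_, fun hmon => ?_⟩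
  · have h := N.norm_Tcomp_sub_le hα.2 hW
    exact ⟨VINet.isClosed_fixedPoints_of_nonexpansive h,
      VINet.convex_fixedPoints_of_nonexpansive h⟩
  · have hF : N.F.Nonempty := by
      refine VINet.nonempty_fixedPoints_of_nonexpansive (N.norm_Tcomp_sub_le hα.2 hW) ?_
      rcases hb with hb | ⟨j, hj⟩
      · exact hb
      · exact N.isBounded_range_Tcomp hj
    exact ⟨hF, N.nonempty_bigF_iff.2 hF⟩
  · have hC := N.inner_idSubWSL_nonneg hmon
    refine ⟨⟨N.isClosed_bigF, N.convex_bigF hC⟩, fun h => ?_⟩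
    have hF : N.bigF.Nonempty := by
      rcases h with h | h | ⟨hW, hcl, hker⟩ | ⟨-, h⟩ | h | ⟨hcl, hker, h⟩ | h
      · exact N.nonempty_bigF_of_surjective h
      · exact N.nonempty_bigF_of_monotone hC h.1
      · exact N.nonempty_bigF_of_norm_le_one hW (N.idSubWSL_surjective hcl hker)
      · exact N.nonempty_bigF_of_dom_conjugate hC h
      · exact N.nonempty_bigF_of_dom_conjugate hC fun i => (h i).2
      · exact N.nonempty_bigF_of_dom hC (N.idSubWSL_surjective hcl hker) h
      · exact N.nonempty_bigF_of_isBounded_dom hC h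
    exact ⟨N.nonempty_bigF_iff.1 hF, hF⟩
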